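/- Let $q$ be a prime power, let $m$ be a positive integer with $(q,m)\neq(2,2)$, let $n=q^m-1$, and let $i$ be an integer with $$3\le i\le m-\left(\left\lfloor\tfrac{m-1}{2}\right\rfloor+\left\lfloor\tfrac{m-3}{3}\right\rfloor\right).$$ For $0\le t\le n-1$ the $q$-cyclotomic coset of $t$ modulo $n$ is $\{tq^j \bmod n: 0\le j<m\}$, and its least element is called a coset leader modulo $n$. Let $\alpha$ be a generator of $\mathbb F_{q^m}^*$ and let $m_j(x)$ be the minimal polynomial of $\alpha^j$ over $\mathbb F_q$. For $2\le\delta\le n$ let $\mathcal C_{(q,n,\delta)}$ be the narrow-sense primitive BCH code of length $n$ over $\mathbb F_q$ with designed distance $\delta$, that is, the cyclic code (ideal of $\mathbb F_q[x]/\langle x^n-1\rangle$) generated by $\operatorname{lcm}(m_1(x),m_2(x),\dots,m_{\delta-1}(x))$. Then there is an $i$-th largest coset leader $\delta_i$ modulo $n$, it equals $$\delta_i=(q-1)q^{m-1}-1-q^{\lfloor (m-1)/2\rfloor+i-2},$$ and the code $\mathcal C_{(q,n,\delta_i)}$ has parameters $[q^m-1,\,k,\,\delta_i]$ (length, dimension,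 minimum Hamming distance), where $$k=\begin{cases} im+1, & \text{if } m \text{ is odd},\\ \left(i-\tfrac12\right)m+1, & \text{if } m \text{ is even}.\end{cases}$$ -/

import Mathlib

open Polynomial

/-- The linear map sending a vector `(c₀, …, c_{n-1})` to the class of
`c₀ + c₁ x + ⋯ + c_{n-1} x^{n-1}` in `F[x] / ⟨x^n - 1⟩`. -/
noncomputable def vecToQuot (F : Type*) [Field F] (n : ℕ) :
    (Fin n → F) →ₗ[F] F[X] ⧸ Ideal.span {(X ^ n - 1 : F[X])} :=
  (Ideal.Quotient.mkₐ F (Ideal.span {(X ^ n - 1 : F[X])})).toLinearMap ∘ₗ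
    ∑ j : Fin n, (monomial (j : ℕ) : F →ₗ[F] F[X]) ∘ₗ LinearMap.proj j

/-- The cyclic code `⟨g(x)⟩` of length `n` over `F`: all vectors whose class lies in the ideal
of `F[x] / ⟨x^n - 1⟩` generated by the class of `g`. -/
noncomputable def cyclicCode {F : Type*} [Field F] (n : ℕ) (g : F[X]) :
    Submodule F (Fin n → F) :=
  ((Ideal.span {Ideal.Quotient.mk (Ideal.span {(X ^ n - 1 : F[X])}) g}).restrictScalars F).comap
    (vecToQuot F n)

open Classical in
/-- `lcm (m_b(x), …, m_{b+δ-2}(x))`, where `m_j` is the minimal polynomial of `β ^ j` over `F`;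
the least common multiple is the monic one. -/
noncomputable def bchGenerator (F : Type*) [Field F] {K : Type*} [Field K] [Algebra F K]
    (β : K) (δ b : ℕ) : F[X] :=
  letI : NormalizedGCDMonoid F[X] := UniqueFactorizationMonoid.toNormalizedGCDMonoid F[X]
  (Finset.Icc b (b + δ - 2)).lcm fun j => minpoly F (β ^ j)

/-- The BCH code of length `n` over `F` with designed distance `δ` and offset `b`, with respect
to the `n`-th root of unity `β`. -/
noncomputable def bchCode (F : Type*) [Field F] {K : Type*} [Field K] [Algebra F K]
    (β : K) (n δ b : ℕ) : Submodule F (Fin n → F) :=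
  cyclicCode n (bchGenerator F β δ b)

open Classical in
/-- `C` is an `[n, k, d]` linear code: it has dimension `k`, and `d` is the least Hamming distance
between two distinct codewords. -/
def HasParameters {F : Type*} [Field F] {n : ℕ} (C : Submodule F (Fin n → F)) (k d : ℕ) : Prop :=
  Module.finrank F C = k ∧
    IsLeast {e : ℕ | ∃ x ∈ C, ∃ y ∈ C, x ≠ y ∧ hammingDist x y = e} d

/-- The `q`-cyclotomic coset `{t q^j mod n : 0 ≤ j < m}`, where `m` is the order of `q` mod `n`. -/
def cyclotomicCoset (q n m t : ℕ) : Finset ℕ :=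
  (Finset.range m).image fun j => t * q ^ j % n

open Classical in
/-- The set of all coset leaders, i.e. of the minima of the cosets of `0 ≤ t ≤ n - 1`. -/
noncomputable def cosetLeaders (q n m : ℕ) : Finset ℕ :=
  {s ∈ Finset.range n | ∃ t < n, IsLeast (cyclotomicCoset q n m t : Set ℕ) s}

/-- `d` is the `i`-th largest element of `S`, counting from `i = 1`. -/
def IsNthLargest (S : Finset ℕ) (i d : ℕ) : Prop :=
  d ∈ S ∧ {e ∈ S | d < e}.card + 1 = i

/-!
# Minimum distance and dimension of narrow-sense primitive BCH codes with a large designed distance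

Put `n = q ^ m - 1`, `e = ⌊(m - 1) / 2⌋ + i - 2`, `r = m - 1 - e` and
`N = n - δ = q ^ (m - 1) + q ^ e`.

**Coset leaders.** Under `s ↦ n - s`, least elements of cosets become largest elements
(`IsCosetMax`), and multiplication by `q` rotates `q`-ary digits. The bound on `i` says
`m < 3 (r + 1)`, so that a coset maximum less than `N`, whose leading digit `1` is followed by `r`
zeros, has no room for three nonzero digits: the coset maxima up to `N` are `q ^ (m - 1)` and
`q ^ (m - 1) + q ^ f` with `m - 2 ≤ 2 f` and `f ≤ e` (`IsCosetMax.eq_pow_or`). This gives the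
`i`-th largest leader. The elements of these cosets are the `q ^ a` and the `q ^ a + q ^ b` whose
exponents are cyclically at distance at least `r` (`IsSpread`); together with `0` they are the
residues that are not conjugate to `1, …, δ - 1`, and their number is the dimension
(`card_not_conjugate`, `finrank_bchCode`).

**Minimum distance.** The BCH bound `le_hammingNorm_of_mem_bchCode` says that nonzero words have
weight at least `δ`. A word of weight `δ` is the evaluation `c_j = f (α ^ j)` of a function
`f : K → F` with `f 0 ≠ 0`, with exactly `q ^ (m - 1) + q ^ e` zeros in `K`, and with
`∑ x, f x * x ^ k = 0` for `1 ≤ k < δ`. The last condition holds if `f` is a polynomial all of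
whose exponents are, modulo `n`, `0`, powers `q ^ u` or spread sums `q ^ u + q ^ v`; so a
quadratic function of a special shape is needed.

With `d = ⌊m / 2⌋` the quadratic form `Q y = Tr (γ y ^ (1 + q ^ d))` is nondegenerate (elliptic
for even `m`, parabolic for odd `m`) for a suitable `γ`, and it only has exponents with the
largest cyclic distance `d`. For `a = d - r` choose a totally singular subspace `I` of dimension
`a`, which exists by Chevalley–Warning. Linear algebra yields a linearized map
`A x = ∑ (μ_k x) ^ (q ^ (-k))`, `0 ≤ k ≤ a`, whose image is the orthogonal space of `I`: its
`a + 1` coefficients have to satisfy `a` linear equations, and its degree bounds its kernel.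
Substituting `A` into `Q` lowers the distance of the exponents by at most `a`, hence keeps it at
least `r`, while the zeros of a quadratic function `Q + L + c` on the orthogonal space of `I` are
easy to count because the function is equidistributed on all cosets of `I` outside that space
(`card_zeros_eq`). The only case with `r = 0` is `m = 2`, where `f` is a product of two parallel
affine functions.
-/

/-! ### Rotation of `q`-ary digits and coset maxima -/

lemma mul_pow_add_modEq (q m x y : ℕ) (hq : 1 ≤ q) :
    x + y ≡ q ^ m * x + y [MOD q ^ m - 1] := by
  refine Nat.ModEq.add_right y ?_
  have h : 1 ≡ q ^ m [MOD q ^ m - 1] := (Nat.modEq_iff_dvd' (Nat.one_le_pow _ _ hq)).2 dvd_rfl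
  simpa using h.mul_right x

lemma pow_modEq_one (q m : ℕ) (hq : 1 ≤ q) : q ^ m ≡ 1 [MOD q ^ m - 1] := by
  simpa using (mul_pow_add_modEq q m 1 0 hq).symm

lemma eq_of_modEq_of_pos {n a b : ℕ} (h : a ≡ b [MOD n]) (ha : 1 ≤ a) (ha' : a ≤ n) (hb : 1 ≤ b)
    (hb' : b ≤ n) : a = b := by
  have h1 : a - 1 ≡ b - 1 [MOD n] := by
    apply Nat.ModEq.add_right_cancel' 1
    rwa [Nat.sub_add_cancel ha, Nat.sub_add_cancel hb]
  have := Nat.ModEq.eq_of_lt_of_lt h1 (by omega) (by omega)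
  omega

/-- `t = q ^ a + q ^ b` where the exponents `a, b < m` have distance at least `r` on the cycle
`ℤ / m`. -/
def IsSpread (q m r t : ℕ) : Prop :=
  ∃ a b, a < m ∧ b + r ≤ a ∧ a + r ≤ m + b ∧ t = q ^ a + q ^ b

lemma IsSpread.exists_modEq_mul {q m r t : ℕ} (hq : 1 ≤ q) (h : IsSpread q m r t) :
    ∃ t', IsSpread q m r t' ∧ t' ≡ t * q [MOD q ^ m - 1] := by
  obtain ⟨a, b, ha, hab, hba, rfl⟩ := h
  rcases Nat.lt_or_ge (a + 1) m with h1 | h1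
  · exact ⟨_, ⟨a + 1, b + 1, h1, by omega, by omega, rfl⟩, by rw [add_mul, pow_succ, pow_succ]⟩
  · obtain rfl : m = a + 1 := by omega
    rcases Nat.lt_or_ge (b + 1) (a + 1) with h2 | h2
    · refine ⟨_, ⟨b + 1, 0, h2, by omega, by omega, rfl⟩, ?_⟩
      have := mul_pow_add_modEq q (a + 1) 1 (q ^ (b + 1)) hq
      rw [mul_one] at this
      rw [add_mul, ← pow_succ, ← pow_succ, pow_zero, Nat.add_comm (q ^ (b + 1)) 1]
      exact this
    · obtain rfl : b = a := by omega
      refine ⟨_, ⟨0, 0, by omega, by omega, by omega, rfl⟩, ?_⟩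
      rw [add_mul, ← pow_succ, pow_zero]
      exact ((pow_modEq_one q (b + 1) hq).add (pow_modEq_one q (b + 1) hq)).symm

lemma IsSpread.exists_modEq_mul_pow {q m r t : ℕ} (hq : 1 ≤ q) (h : IsSpread q m r t) (l : ℕ) :
    ∃ t', IsSpread q m r t' ∧ t' ≡ t * q ^ l [MOD q ^ m - 1] := by
  induction l with
  | zero => exact ⟨t, h, by simp [Nat.ModEq.refl]⟩
  | succ l ih =>
    obtain ⟨t', h', ht'⟩ := ih
    obtain ⟨t'', h'', ht''⟩ := h'.exists_modEq_mul hq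
    exact ⟨t'', h'', ht''.trans (by rw [pow_succ, ← mul_assoc]; exact ht'.mul_right q)⟩

lemma IsSpread.le {q m r t : ℕ} (hq : 1 ≤ q) (h : IsSpread q m r t) :
    t ≤ q ^ (m - 1) + q ^ (m - 1 - r) := by
  obtain ⟨a, b, ha, hab, hba, rfl⟩ := h
  exact add_le_add (Nat.pow_le_pow_right hq (by omega)) (Nat.pow_le_pow_right hq (by omega))

lemma IsSpread.pos {q m r t : ℕ} (hq : 1 ≤ q) (h : IsSpread q m r t) : 1 ≤ t := by
  obtain ⟨a, b, ha, hab, hba, rfl⟩ := h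
  have := Nat.one_le_pow a q hq
  omega

lemma exists_pow_modEq_mul_pow {q m a : ℕ} (hq : 1 ≤ q) (ha : a < m) (l : ℕ) :
    ∃ b < m, q ^ b ≡ q ^ a * q ^ l [MOD q ^ m - 1] := by
  refine ⟨(a + l) % m, Nat.mod_lt _ (by omega), ?_⟩
  rw [← pow_add]
  conv_rhs => rw [← Nat.div_add_mod (a + l) m, pow_add, pow_mul]
  simpa using ((pow_modEq_one q m hq).symm.pow ((a + l) / m)).mul_right (q ^ ((a + l) % m))

/-- `t` is the largest representative in `{1, …, n}` of its `q`-cyclotomic coset modulo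
`n = q ^ m - 1`. -/
def IsCosetMax (q m t : ℕ) : Prop :=
  ∀ j u, 1 ≤ u → u ≤ q ^ m - 1 → u ≡ t * q ^ j [MOD q ^ m - 1] → u ≤ t

lemma IsCosetMax.pow {q m : ℕ} (hq : 2 ≤ q) (hm : 1 ≤ m) : IsCosetMax q m (q ^ (m - 1)) := by
  intro j u hu1 hu2 hu
  obtain ⟨b, hb, hb'⟩ := exists_pow_modEq_mul_pow (q := q) (m := m) (a := m - 1) (by omega)
    (by omega) j
  have h1 : q ^ b ≤ q ^ (m - 1) := Nat.pow_le_pow_right (by omega) (by omega)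
  have h2 : q ^ (m - 1) < q ^ m := Nat.pow_lt_pow_right hq (by omega)
  have := eq_of_modEq_of_pos (hu.trans hb'.symm) hu1 hu2 (Nat.one_le_pow _ _ (by omega)) (by omega)
  omega

lemma IsCosetMax.pow_add_pow {q m f : ℕ} (hq : 2 ≤ q) (hf : f < m) (hf' : m - 2 ≤ 2 * f)
    (hn : q ^ (m - 1) + q ^ f ≤ q ^ m - 1) : IsCosetMax q m (q ^ (m - 1) + q ^ f) := by
  intro j u hu1 hu2 hu
  have hs : IsSpread q m (m - 1 - f) (q ^ (m - 1) + q ^ f) :=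
    ⟨m - 1, f, by omega, by omega, by omega, rfl⟩
  obtain ⟨t', h', ht'⟩ := hs.exists_modEq_mul_pow (by omega) j
  have h1 := h'.le (by omega)
  rw [show m - 1 - (m - 1 - f) = f by omega] at h1
  have := eq_of_modEq_of_pos (hu.trans ht'.symm) hu1 hu2 (h'.pos (by omega)) (by omega)
  omega

/-- The coset maxima up to `q ^ (m - 1) + q ^ e` have at most two nonzero `q`-ary digits. Rotating
the second nonzero digit of `t` to the top shows that the digits of `t` below it are very small;
rotating a third one to the top would then force three blocks of zeros that do not fit into `m`
positions. -/
lemma IsCosetMax.eq_pow_or {q m e t : ℕ} (hq : 2 ≤ q) (he : e < m) (hme : m < 3 * (m - e))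
    (he' : m - 2 ≤ 2 * e) (ht1 : 1 ≤ t) (htop : IsCosetMax q m t)
    (hte : t ≤ q ^ (m - 1) + q ^ e) :
    t = q ^ (m - 1) ∨ ∃ f, m - 2 ≤ 2 * f ∧ f ≤ e ∧ t = q ^ (m - 1) + q ^ f := by
  have hq1 : 1 ≤ q := by omega
  have hlow : q ^ (m - 1) ≤ t := by
    by_contra! hlt
    have h1 : t * q + q ≤ q ^ m := by
      calc t * q + q = (t + 1) * q := by ring
        _ ≤ q ^ (m - 1) * q := Nat.mul_le_mul_right _ hlt
        _ = q ^ m := by rw [← pow_succ]; congr 1; omega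
    have h2 := htop 1 (t * q) (Nat.mul_pos ht1 (by omega)) (by omega)
      (by rw [pow_one])
    nlinarith
  obtain ⟨u, rfl⟩ := Nat.exists_eq_add_of_le hlow
  have hue : u ≤ q ^ e := by omega
  rcases Nat.eq_zero_or_pos u with rfl | hu
  · exact Or.inl rfl
  right
  rcases hue.eq_or_lt with rfl | hue
  · exact ⟨e, he', le_rfl, rfl⟩
  obtain ⟨f, hfu, huf⟩ : ∃ f, q ^ f ≤ u ∧ u < q ^ (f + 1) :=
    ⟨Nat.log q u, Nat.pow_log_le_self q hu.ne', Nat.lt_pow_succ_log_self hq u⟩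
  have hfe : f < e := (Nat.pow_lt_pow_iff_right hq).1 (hfu.trans_lt hue)
  obtain ⟨j, hj⟩ : ∃ j, m = f + j + 2 := ⟨m - 2 - f, by omega⟩
  -- rotate the leading digit of `u` to the top
  have hV : u * q ^ (j + 1) + q ^ j ≤ q ^ (m - 1) + u := by
    refine htop (j + 1) _ (Nat.succ_le_of_lt (by positivity)) ?_ ?_
    · have h1 : (u + 1) * q ^ (j + 1) ≤ q ^ m := by
        calc (u + 1) * q ^ (j + 1) ≤ q ^ (f + 1) * q ^ (j + 1) := Nat.mul_le_mul_right _ huf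
          _ = q ^ m := by rw [← pow_add]; congr 1; omega
      have h2 : q ^ j < q ^ (j + 1) := Nat.pow_lt_pow_right hq (by omega)
      rw [add_mul, one_mul] at h1
      omega
    · have h := mul_pow_add_modEq q m (q ^ j) (u * q ^ (j + 1)) hq1
      rw [add_comm (q ^ j)] at h
      have h3 : (q ^ (m - 1) + u) * q ^ (j + 1) = q ^ m * q ^ j + u * q ^ (j + 1) := by
        rw [add_mul, ← pow_add, ← pow_add]; congr 2; omega
      rwa [h3]
  have hm1 : q ^ (m - 1) = q ^ f * q ^ (j + 1) := by rw [← pow_add]; congr 1; omega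
  obtain ⟨v, rfl⟩ := Nat.exists_eq_add_of_le hfu
  have hV' : v * q ^ (j + 1) + q ^ j ≤ q ^ f + v := by
    rw [hm1, add_mul] at hV; omega
  rcases Nat.eq_zero_or_pos v with rfl | hv
  · refine ⟨f, ?_, hfe.le, by simp⟩
    have : j ≤ f := (Nat.pow_le_pow_iff_right hq).1 (by simpa using hV')
    omega
  exfalso
  obtain ⟨g, hgv, hvg⟩ : ∃ g, q ^ g ≤ v ∧ v < q ^ (g + 1) :=
    ⟨Nat.log q v, Nat.pow_log_le_self q hv.ne', Nat.lt_pow_succ_log_self hq v⟩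
  have hgf : g + (j + 1) ≤ f := by
    have h1 : q ^ (g + (j + 1)) < q ^ (f + 1) := by
      calc q ^ (g + (j + 1)) = q ^ g * q ^ (j + 1) := pow_add _ _ _
        _ ≤ v * q ^ (j + 1) := Nat.mul_le_mul_right _ hgv
        _ < q ^ (f + 1) := by have : 0 < q ^ j := by positivity
                              omega
    have := (Nat.pow_lt_pow_iff_right hq).1 h1
    omega
  obtain ⟨k, hk⟩ : ∃ k, f = g + k + 1 := ⟨f - g - 1, by omega⟩
  -- rotate the leading digit of `v` to the top
  have hW : v * q ^ (m - 1 - g) + (q ^ (m - 2 - g) + q ^ k) ≤ q ^ (m - 1) + (q ^ f + v) := by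
    refine htop (m - 1 - g) _ (Nat.succ_le_of_lt (by positivity)) ?_ ?_
    · have h1 : (v + 1) * q ^ (m - 1 - g) ≤ q ^ m := by
        calc (v + 1) * q ^ (m - 1 - g) ≤ q ^ (g + 1) * q ^ (m - 1 - g) :=
              Nat.mul_le_mul_right _ hvg
          _ = q ^ m := by rw [← pow_add]; congr 1; omega
      have h2 : q ^ k < q ^ (m - 2 - g) := Nat.pow_lt_pow_right hq (by omega)
      have h3 : q ^ (m - 1 - g) = q ^ (m - 2 - g) * q := by rw [← pow_succ]; congr 1; omega
      have h4 : q ^ (m - 2 - g) * 2 ≤ q ^ (m - 2 - g) * q := Nat.mul_le_mul_left _ hq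
      rw [add_mul, one_mul] at h1
      omega
    · have h := mul_pow_add_modEq q m (q ^ (m - 2 - g) + q ^ k) (v * q ^ (m - 1 - g)) hq1
      rw [add_comm (q ^ (m - 2 - g) + q ^ k)] at h
      have h3 : (q ^ (m - 1) + (q ^ f + v)) * q ^ (m - 1 - g) =
          q ^ m * (q ^ (m - 2 - g) + q ^ k) + v * q ^ (m - 1 - g) := by
        have e1 : q ^ (m - 1) * q ^ (m - 1 - g) = q ^ m * q ^ (m - 2 - g) := by
          rw [← pow_add, ← pow_add]; congr 1; omega
        have e2 : q ^ f * q ^ (m - 1 - g) = q ^ m * q ^ k := by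
          rw [← pow_add, ← pow_add]; congr 1; omega
        rw [add_mul, add_mul, e1, e2]; ring
      rwa [h3]
  have h5 : q ^ (m - 1) ≤ v * q ^ (m - 1 - g) := by
    calc q ^ (m - 1) = q ^ g * q ^ (m - 1 - g) := by rw [← pow_add]; congr 1; omega
      _ ≤ _ := Nat.mul_le_mul_right _ hgv
  have h6 : q ^ (m - 2 - g) < q ^ (f + 1) := by
    have : 0 < q ^ k := by positivity
    omega
  have := (Nat.pow_lt_pow_iff_right hq).1 h6
  omega

/-! ### Coset leaders and residues not conjugate to small ones -/

lemma modEq_mul_pow_symm {q m x y j : ℕ} (hq : 1 ≤ q) (hm : 1 ≤ m)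
    (h : x ≡ y * q ^ j [MOD q ^ m - 1]) : ∃ l, y ≡ x * q ^ l [MOD q ^ m - 1] := by
  refine ⟨(m - 1) * j, ?_⟩
  have h1 := h.mul_right (q ^ ((m - 1) * j))
  have h2 : y * q ^ j * q ^ ((m - 1) * j) = y * (q ^ m) ^ j := by
    rw [mul_assoc, ← pow_add, ← pow_mul]
    congr 2
    obtain ⟨k, rfl⟩ : ∃ k, m = k + 1 := ⟨m - 1, by omega⟩
    rw [Nat.add_sub_cancel]; ring
  rw [h2] at h1
  have h3 := ((pow_modEq_one q m hq).pow j).mul_left y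
  rw [one_pow, mul_one] at h3
  exact (h1.trans h3).symm

lemma modEq_mul_iff_of_add_eq {n s t k u c : ℕ} (hst : s + t = n) (hku : k + u = n) :
    s ≡ k * c [MOD n] ↔ t ≡ u * c [MOD n] := by
  have h1 : (s : ZMod n) = -t := by
    rw [eq_neg_iff_add_eq_zero, ← Nat.cast_add, hst, ZMod.natCast_self]
  have h2 : (k : ZMod n) = -u := by
    rw [eq_neg_iff_add_eq_zero, ← Nat.cast_add, hku, ZMod.natCast_self]
  rw [← ZMod.natCast_eq_natCast_iff, ← ZMod.natCast_eq_natCast_iff]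
  push_cast
  rw [h1, h2, neg_mul, neg_inj]

/-- The residues all of whose conjugates are at most `q ^ (m - 1) + q ^ (m - 1 - r)`: their coset
maxima are known, and powers and spread sums are closed under rotation. -/
lemma forall_modEq_le_iff {q m r t : ℕ} (hq : 2 ≤ q) (hr : 2 * r ≤ m) (hm : m < 3 * (r + 1))
    (hn : q ^ (m - 1) + q ^ (m - 1 - r) ≤ q ^ m - 1) (ht : 1 ≤ t) (htn : t ≤ q ^ m - 1) :
    (∀ j u, 1 ≤ u → u ≤ q ^ m - 1 → u ≡ t * q ^ j [MOD q ^ m - 1] →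
      u ≤ q ^ (m - 1) + q ^ (m - 1 - r)) ↔ (∃ a < m, q ^ a = t) ∨ IsSpread q m r t := by
  have hm0 : 1 ≤ m := by
    by_contra! h
    obtain rfl : m = 0 := by omega
    simp at hn
  constructor
  · intro h
    -- the largest conjugate of `t`
    obtain ⟨M, ⟨hM1, hMn, j, hMj⟩, hmax⟩ : ∃ M, (1 ≤ M ∧ M ≤ q ^ m - 1 ∧
        ∃ j, M ≡ t * q ^ j [MOD q ^ m - 1]) ∧ ∀ u, (1 ≤ u ∧ u ≤ q ^ m - 1 ∧
        ∃ j, u ≡ t * q ^ j [MOD q ^ m - 1]) → u ≤ M := by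
      have hfin : {u | 1 ≤ u ∧ u ≤ q ^ m - 1 ∧ ∃ j, u ≡ t * q ^ j [MOD q ^ m - 1]}.Finite :=
        (Set.finite_Iic (q ^ m - 1)).subset fun u hu => hu.2.1
      obtain ⟨M, hM⟩ := hfin.exists_maximal ⟨t, ht, htn, 0, by simp [Nat.ModEq.refl]⟩
      exact ⟨M, hM.prop, fun u hu => (le_total u M).elim id fun h => hM.2 hu h⟩
    have htop : IsCosetMax q m M := by
      intro l u hu1 hun hu
      refine hmax u ⟨hu1, hun, j + l, hu.trans ?_⟩
      rw [pow_add, ← mul_assoc]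
      exact hMj.mul_right _
    obtain ⟨l, hl⟩ := modEq_mul_pow_symm (by omega) hm0 hMj
    rcases htop.eq_pow_or hq (e := m - 1 - r) (by omega) (by omega) (by omega) hM1
        (h j M hM1 hMn hMj) with rfl | ⟨f, hf1, hf2, rfl⟩
    · obtain ⟨b, hb, hb'⟩ := exists_pow_modEq_mul_pow (q := q) (m := m) (a := m - 1) (by omega)
        (by omega) l
      have h2 : q ^ b ≤ q ^ (m - 1) := Nat.pow_le_pow_right (by omega) (by omega)
      exact Or.inl ⟨b, hb, eq_of_modEq_of_pos (hb'.trans hl.symm)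
        (Nat.one_le_pow _ _ (by omega)) (by omega) ht htn⟩
    · right
      have hs : IsSpread q m r (q ^ (m - 1) + q ^ f) :=
        ⟨m - 1, f, by omega, by omega, by omega, rfl⟩
      obtain ⟨t', h', ht'⟩ := hs.exists_modEq_mul_pow (by omega) l
      have := eq_of_modEq_of_pos (hl.trans ht'.symm) ht htn (h'.pos (by omega))
        ((h'.le (by omega)).trans hn)
      rwa [this]
  · rintro (⟨a, ha, rfl⟩ | hs) j u hu1 hun hu
    · obtain ⟨b, hb, hb'⟩ := exists_pow_modEq_mul_pow (q := q) (by omega) ha j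
      have h2 : q ^ b ≤ q ^ (m - 1) := Nat.pow_le_pow_right (by omega) (by omega)
      rw [eq_of_modEq_of_pos (hu.trans hb'.symm) hu1 hun (Nat.one_le_pow _ _ (by omega))
        (by omega)]
      omega
    · obtain ⟨t', h', ht'⟩ := hs.exists_modEq_mul_pow (by omega) j
      have h2 := h'.le (by omega)
      rw [eq_of_modEq_of_pos (hu.trans ht'.symm) hu1 hun (h'.pos (by omega)) (by omega)]
      exact h2

lemma pow_add_pow_inj {q a b a' b' : ℕ} (hq : 2 ≤ q) (hab : b ≤ a) (hab' : b' ≤ a')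
    (h : q ^ a + q ^ b = q ^ a' + q ^ b') : a = a' ∧ b = b' := by
  have key : ∀ {a b a' b' : ℕ}, b ≤ a → a < a' → q ^ a + q ^ b ≠ q ^ a' + q ^ b' := by
    intro a b a' b' hab haa' h
    have h1 : q ^ b ≤ q ^ a := Nat.pow_le_pow_right (by omega) hab
    have h2 : q ^ (a + 1) ≤ q ^ a' := Nat.pow_le_pow_right (by omega) haa'
    have h3 : 1 ≤ q ^ b' := Nat.one_le_pow _ _ (by omega)
    have h4 : q ^ a * 2 ≤ q ^ a * q := Nat.mul_le_mul_left _ hq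
    rw [pow_succ] at h2
    omega
  obtain h1 | rfl | h1 := lt_trichotomy a a'
  · exact absurd h (key hab h1)
  · exact ⟨rfl, Nat.pow_right_injective hq (by simpa using h)⟩
  · exact absurd h.symm (key hab' h1)

lemma two_mul_sum_Icc_sub {m r : ℕ} (hr : 2 * r ≤ m) :
    2 * ∑ v ∈ Finset.Icc r (m - r), (m - v) = m * (m + 1 - 2 * r) := by
  have h1 : ∑ v ∈ Finset.Icc r (m - r), (m - v) = ∑ v ∈ Finset.Icc r (m - r), v :=
    Finset.sum_nbij' (fun v => m - v) (fun v => m - v)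
      (fun v hv => by simp only [Finset.mem_Icc] at *; omega)
      (fun v hv => by simp only [Finset.mem_Icc] at *; omega)
      (fun v hv => by simp only [Finset.mem_Icc] at *; omega)
      (fun v hv => by simp only [Finset.mem_Icc] at *; omega)
      (fun v hv => rfl)
  have h2 : ∑ v ∈ Finset.Icc r (m - r), ((m - v) + v) = ∑ v ∈ Finset.Icc r (m - r), m :=
    Finset.sum_congr rfl fun v hv => by simp only [Finset.mem_Icc] at hv; omega
  rw [Finset.sum_add_distrib, ← h1, Finset.sum_const, Nat.card_Icc, smul_eq_mul] at h2
  rw [two_mul, h2, mul_comm]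
  congr 1; omega

open Classical in
/-- The hypothesis `1 ≤ r ∨ 3 ≤ q` excludes the coincidence `2 ^ a + 2 ^ a = 2 ^ (a + 1)`. -/
lemma card_pow_or_isSpread {q m r n : ℕ} (hq : 2 ≤ q) (hr : 2 * r ≤ m) (hrq : 1 ≤ r ∨ 3 ≤ q)
    (hn : q ^ (m - 1) + q ^ (m - 1 - r) ≤ n) :
    2 * ((Finset.Icc 1 n).filter fun t => (∃ a < m, q ^ a = t) ∨ IsSpread q m r t).card =
      2 * m + m * (m + 1 - 2 * r) := by
  have hq1 : 1 ≤ q := by omega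
  have hset : ((Finset.Icc 1 n).filter fun t => (∃ a < m, q ^ a = t) ∨ IsSpread q m r t) =
      (Finset.range m).image (fun a => q ^ a) ∪
        ((Finset.Icc r (m - r)).sigma fun v => Finset.range (m - v)).image
          (fun p => q ^ (p.2 + p.1) + q ^ p.2) := by
    ext t
    simp only [Finset.mem_filter, Finset.mem_Icc, Finset.mem_union, Finset.mem_image,
      Finset.mem_range, Finset.mem_sigma, Sigma.exists]
    constructor
    · rintro ⟨-, h | ⟨a, b, ha, hab, hba, rfl⟩⟩
      · exact Or.inl h
      · refine Or.inr ⟨a - b, b, ⟨by omega, by omega⟩, ?_⟩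
        rw [show b + (a - b) = a by omega]
    · rintro (⟨a, ha, rfl⟩ | ⟨v, b, ⟨hv, hb⟩, rfl⟩)
      · have h2 : q ^ a ≤ q ^ (m - 1) := Nat.pow_le_pow_right (by omega) (by omega)
        exact ⟨⟨Nat.one_le_pow _ _ hq1, by omega⟩, Or.inl ⟨a, ha, rfl⟩⟩
      · have h : IsSpread q m r (q ^ (b + v) + q ^ b) :=
          ⟨b + v, b, by omega, by omega, by omega, rfl⟩
        exact ⟨⟨h.pos hq1, (h.le hq1).trans hn⟩, Or.inr h⟩
  rw [hset, Finset.card_union_of_disjoint, Finset.card_image_of_injective _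
    (Nat.pow_right_injective hq), Finset.card_range, Finset.card_image_of_injOn,
    Finset.card_sigma]
  · simp only [Finset.card_range]
    rw [mul_add, two_mul_sum_Icc_sub hr]
  · rintro ⟨v, b⟩ - ⟨v', b'⟩ - h
    obtain ⟨h1, rfl⟩ := pow_add_pow_inj hq (Nat.le_add_right _ _) (Nat.le_add_right _ _) h
    simp only at h1
    obtain rfl : v = v' := by omega
    rfl
  · rw [Finset.disjoint_left]
    simp only [Finset.mem_image, Finset.mem_sigma, Finset.mem_range, Finset.mem_Icc]
    rintro _ ⟨a, ha, rfl⟩ ⟨⟨v, b⟩, ⟨hv, hb⟩, h⟩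
    simp only at hv hb h
    have h0 : 1 ≤ q ^ b := Nat.one_le_pow _ _ hq1
    have h1 : b + v < a := (Nat.pow_lt_pow_iff_right hq).1 (by omega)
    have h2 : q ^ (b + v + 1) ≤ q ^ a := Nat.pow_le_pow_right hq1 h1
    rw [pow_succ] at h2
    rcases hrq with hr1 | hq3
    · have h3 : q ^ b < q ^ (b + v) := Nat.pow_lt_pow_right hq (by omega)
      nlinarith
    · have h3 : q ^ b ≤ q ^ (b + v) := Nat.pow_le_pow_right hq1 (by omega)
      nlinarith

open Classical in
/-- The number of residues that are not conjugate to any of `1, …, δ - 1`. -/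
lemma card_not_conjugate {q m r δ : ℕ} (hq : 2 ≤ q) (hr : 2 * r ≤ m) (hm : m < 3 * (r + 1))
    (hδ : δ + (q ^ (m - 1) + q ^ (m - 1 - r)) = q ^ m - 1) (hδ1 : 1 ≤ δ) :
    2 * ((Finset.range (q ^ m - 1)).filter fun s => ∀ k j, 1 ≤ k → k < δ →
      ¬ s ≡ k * q ^ j [MOD q ^ m - 1]).card = 2 + 2 * m + m * (m + 1 - 2 * r) := by
  have hq1 : 1 ≤ q := by omega
  -- for `q = 2` and `r = 0` the hypothesis on `δ` would read `δ + 2 ^ m = 2 ^ m - 1`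
  have hrq : 1 ≤ r ∨ 3 ≤ q := by
    by_contra! h
    obtain ⟨rfl, rfl⟩ : r = 0 ∧ q = 2 := by omega
    rcases Nat.eq_zero_or_pos m with rfl | hm0
    · simp at hδ
    · have : 2 ^ m = 2 * 2 ^ (m - 1) := by rw [← pow_succ']; congr 1; omega
      simp at hδ
      omega
  have hm0 : 1 ≤ m := by
    by_contra! h
    obtain rfl : m = 0 := by omega
    simp at hδ
  set n := q ^ m - 1 with hn
  have hset : ((Finset.range n).filter fun s => ∀ k j, 1 ≤ k → k < δ →
      ¬ s ≡ k * q ^ j [MOD n]) = insert 0 (((Finset.Icc 1 (n - 1)).filter fun t =>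
        (∃ a < m, q ^ a = t) ∨ IsSpread q m r t).image fun t => n - t) := by
    have key : ∀ s t, 1 ≤ s → 1 ≤ t → s + t = n → ((∀ k j, 1 ≤ k → k < δ →
        ¬ s ≡ k * q ^ j [MOD n]) ↔ ((∃ a < m, q ^ a = t) ∨ IsSpread q m r t)) := by
      intro s t hs ht hst
      rw [← forall_modEq_le_iff hq hr hm (by omega) ht (by omega)]
      constructor
      · intro h j u hu1 hun hu
        by_contra! hlt
        obtain ⟨l, hl⟩ := modEq_mul_pow_symm hq1 hm0 hu
        rcases hun.eq_or_lt with rfl | hun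
        · rw [← hn] at hl
          have h0 : t ≡ 0 [MOD n] := hl.trans (by
            simpa using (Nat.modEq_zero_iff_dvd.2 (dvd_refl n)).mul_right (q ^ l))
          have := Nat.le_of_dvd ht ((Nat.modEq_zero_iff_dvd).1 h0)
          omega
        · exact h (n - u) l (by omega) (by omega)
            ((modEq_mul_iff_of_add_eq hst (by omega)).2 hl)
      · intro h k j hk1 hk hc
        have h1 := (modEq_mul_iff_of_add_eq (u := n - k) hst (by omega)).1 hc
        obtain ⟨l, hl⟩ := modEq_mul_pow_symm hq1 hm0 h1
        have := h l (n - k) (by omega) (by omega) hl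
        omega
    ext s
    simp only [Finset.mem_filter, Finset.mem_insert, Finset.mem_image, Finset.mem_range,
      Finset.mem_Icc]
    constructor
    · rintro ⟨hsn, h⟩
      rcases Nat.eq_zero_or_pos s with rfl | hs
      · exact Or.inl rfl
      · exact Or.inr ⟨n - s, ⟨by omega, (key s (n - s) hs (by omega) (by omega)).1 h⟩, by omega⟩
    · rintro (rfl | ⟨t, ⟨ht, h⟩, rfl⟩)
      · refine ⟨by omega, fun k j hk1 hk hc => ?_⟩
        obtain ⟨l, hl⟩ := modEq_mul_pow_symm hq1 hm0 hc
        rw [zero_mul] at hl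
        have := Nat.le_of_dvd hk1 ((Nat.modEq_zero_iff_dvd).1 hl)
        omega
      · refine ⟨?_, (key (n - t) t ?_ ?_ ?_).2 h⟩ <;> clear h <;> omega
  rw [hset, Finset.card_insert_of_notMem, Finset.card_image_of_injOn]
  · have := card_pow_or_isSpread (n := n - 1) hq hr hrq (by omega)
    omega
  · intro x hx y hy h
    have hx' := Finset.mem_Icc.1 (Finset.mem_filter.1 hx).1
    have hy' := Finset.mem_Icc.1 (Finset.mem_filter.1 hy).1
    simp only at h
    omega
  · simp only [Finset.mem_image, Finset.mem_filter, Finset.mem_Icc, not_exists]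
    omega

lemma mem_cosetLeaders_iff {q m s : ℕ} (hq : 1 ≤ q) (hm : 1 ≤ m) :
    s ∈ cosetLeaders q (q ^ m - 1) m ↔
      s < q ^ m - 1 ∧ ∀ j, s ≤ s * q ^ j % (q ^ m - 1) := by
  set n := q ^ m - 1 with hn
  have hred : ∀ t j, t * q ^ j % n = t * q ^ (j % m) % n := by
    intro t j
    conv_lhs => rw [← Nat.div_add_mod j m, pow_add, pow_mul]
    have h := (((pow_modEq_one q m hq).pow (j / m)).mul_right (q ^ (j % m))).mul_left t
    rwa [one_pow, one_mul] at h
  simp only [cosetLeaders, Finset.mem_filter, Finset.mem_range, and_congr_right_iff]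
  intro hs
  constructor
  · rintro ⟨t, ht, h1, h2⟩ j
    simp only [cyclotomicCoset, Finset.coe_image, Finset.coe_range, Set.mem_image,
      Set.mem_Iio] at h1
    obtain ⟨l, hl, rfl⟩ := h1
    apply h2
    simp only [cyclotomicCoset, Finset.coe_image, Finset.coe_range, Set.mem_image,
      Set.mem_Iio]
    refine ⟨(l + j) % m, Nat.mod_lt _ hm, ?_⟩
    rw [← hred, pow_add, ← mul_assoc, Nat.mod_mul_mod]
  · intro h
    refine ⟨s, hs, ?_, ?_⟩
    · simp only [cyclotomicCoset, Finset.coe_image, Finset.coe_range, Set.mem_image,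
        Set.mem_Iio]
      exact ⟨0, hm, by simpa using Nat.mod_eq_of_lt hs⟩
    · rintro _ hx
      simp only [cyclotomicCoset, Finset.coe_image, Finset.coe_range, Set.mem_image,
        Set.mem_Iio] at hx
      obtain ⟨j, -, rfl⟩ := hx
      exact h j

lemma mem_cosetLeaders_iff_isCosetMax {q m s t : ℕ} (hq : 1 ≤ q) (hm : 1 ≤ m) (ht : 1 ≤ t)
    (hst : s + t = q ^ m - 1) : s ∈ cosetLeaders q (q ^ m - 1) m ↔ IsCosetMax q m t := by
  rw [mem_cosetLeaders_iff hq hm]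
  constructor
  · rintro ⟨-, h⟩ j u hu1 hun hu
    have h1 := (modEq_mul_iff_of_add_eq (k := s) (s := q ^ m - 1 - u) (by omega) hst).2 hu
    have h2 := h j
    rw [← show _ = _ from h1, Nat.mod_eq_of_lt (by omega)] at h2
    omega
  · intro h
    refine ⟨by omega, fun j => ?_⟩
    have h0 : s * q ^ j % (q ^ m - 1) < q ^ m - 1 := Nat.mod_lt _ (by omega)
    have := h j (q ^ m - 1 - s * q ^ j % (q ^ m - 1)) (by omega) (by omega)
      ((modEq_mul_iff_of_add_eq (s := s * q ^ j % (q ^ m - 1)) (by omega) hst).1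
        (Nat.mod_modEq _ _))
    omega

open Classical in
lemma isNthLargest_cosetLeaders {q m e δ : ℕ} (hq : 2 ≤ q) (he : e < m)
    (hme : m < 3 * (m - e)) (he' : (m - 1) / 2 ≤ e)
    (hδ : δ + (q ^ (m - 1) + q ^ e) = q ^ m - 1) :
    IsNthLargest (cosetLeaders q (q ^ m - 1) m) (e - (m - 1) / 2 + 2) δ := by
  have hq1 : 1 ≤ q := by omega
  have hp : ∀ k, 1 ≤ q ^ k := fun k => Nat.one_le_pow _ _ hq1
  have hp1 := hp (m - 1)
  refine ⟨(mem_cosetLeaders_iff_isCosetMax hq1 (by omega) (by omega) hδ).2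
    (.pow_add_pow hq he (by omega) (by omega)), ?_⟩
  have hset : {s ∈ cosetLeaders q (q ^ m - 1) m | δ < s} =
      insert (q ^ m - 1 - q ^ (m - 1)) ((Finset.Ico ((m - 1) / 2) e).image
        fun f => q ^ m - 1 - (q ^ (m - 1) + q ^ f)) := by
    ext s
    simp only [Finset.mem_filter, Finset.mem_insert, Finset.mem_image, Finset.mem_Ico]
    constructor
    · rintro ⟨h, hs⟩
      have hsn := ((mem_cosetLeaders_iff hq1 (by omega)).1 h).1
      have := (mem_cosetLeaders_iff_isCosetMax (t := q ^ m - 1 - s) hq1 (by omega) (by omega)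
        (by omega)).1 h
      rcases this.eq_pow_or hq he hme (by omega) (by omega) (by omega) with h1 | ⟨f, hf, hfe, h1⟩
      · left; omega
      · refine Or.inr ⟨f, ⟨by omega, hfe.lt_of_ne ?_⟩, by omega⟩
        rintro rfl
        omega
    · rintro (rfl | ⟨f, ⟨hf, hfe⟩, rfl⟩)
      · have := hp e
        exact ⟨(mem_cosetLeaders_iff_isCosetMax hq1 (by omega) hp1 (by omega)).2
          (.pow hq (by omega)), by omega⟩
      · have : q ^ f < q ^ e := Nat.pow_lt_pow_right hq hfe
        exact ⟨(mem_cosetLeaders_iff_isCosetMax (t := q ^ (m - 1) + q ^ f) hq1 (by omega)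
          (by omega) (by omega)).2 (.pow_add_pow hq (by omega) (by omega) (by omega)), by omega⟩
  rw [hset, Finset.card_insert_of_notMem, Finset.card_image_of_injOn, Nat.card_Ico]
  · intro f hf f' hf' h
    simp only [Finset.coe_Ico, Set.mem_Ico] at hf hf' h
    have h1 : q ^ f < q ^ e := Nat.pow_lt_pow_right hq hf.2
    have h2 : q ^ f' < q ^ e := Nat.pow_lt_pow_right hq hf'.2
    exact Nat.pow_right_injective hq (show q ^ f = q ^ f' by omega)
  · simp only [Finset.mem_image, Finset.mem_Ico, not_exists, not_and]
    intro f hf h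
    have h1 : q ^ f < q ^ e := Nat.pow_lt_pow_right hq hf.2
    have := hp f
    omega

/-! ### Cyclic codes, the BCH bound and the dimension of BCH codes -/

section CyclicCodes

variable {F : Type*} [Field F]

/-- The polynomial with coefficient vector `c`. -/
noncomputable def vecPoly (F : Type*) [Field F] (n : ℕ) : (Fin n → F) →ₗ[F] F[X] :=
  ∑ j : Fin n, (monomial (j : ℕ) : F →ₗ[F] F[X]) ∘ₗ LinearMap.proj j

lemma vecPoly_apply {n : ℕ} (c : Fin n → F) :
    vecPoly F n c = ∑ j : Fin n, monomial (j : ℕ) (c j) := by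
  simp [vecPoly]

lemma exists_vecPoly_eq {n : ℕ} {p : F[X]} (hp : p.natDegree < n) : ∃ c, vecPoly F n c = p := by
  refine ⟨fun j => p.coeff j, ?_⟩
  rw [vecPoly_apply, Fin.sum_univ_eq_sum_range (fun j => monomial j (p.coeff j)) n]
  exact (p.as_sum_range' n hp).symm

lemma mem_cyclicCode_iff {n : ℕ} {g : F[X]} (hg : g ∣ X ^ n - 1) (c : Fin n → F) :
    c ∈ cyclicCode n g ↔ g ∣ vecPoly F n c := by
  rw [cyclicCode, Submodule.mem_comap, Submodule.restrictScalars_mem]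
  change Ideal.Quotient.mk _ (vecPoly F n c) ∈ _ ↔ _
  have h : Ideal.span {Ideal.Quotient.mk (Ideal.span {(X ^ n - 1 : F[X])}) g} =
      (Ideal.span {g}).map (Ideal.Quotient.mk (Ideal.span {(X ^ n - 1 : F[X])})) := by
    rw [Ideal.map_span, Set.image_singleton]
  rw [h, Ideal.mem_quotient_iff_mem (Ideal.span_singleton_le_span_singleton.2 hg),
    Ideal.mem_span_singleton]

/-- The code is the kernel of the surjection `c ↦ c(x)` onto `F[x] / ⟨g⟩`. -/
lemma finrank_cyclicCode {n : ℕ} {g : F[X]} (hn : 1 ≤ n) (hg : g ∣ X ^ n - 1) :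
    Module.finrank F (cyclicCode n g) + g.natDegree = n := by
  have hX : (X ^ n - 1 : F[X]) ≠ 0 := X_pow_sub_C_ne_zero hn 1
  have hg0 : g ≠ 0 := fun h => hX (by rwa [h, zero_dvd_iff] at hg)
  have hdeg : g.natDegree ≤ n := by
    have := natDegree_le_of_dvd hg hX
    rwa [show (X ^ n - 1 : F[X]) = X ^ n - C 1 by simp, natDegree_X_pow_sub_C] at this
  let φ : (Fin n → F) →ₗ[F] AdjoinRoot g := (AdjoinRoot.mkₐ g).toLinearMap ∘ₗ vecPoly F n
  have hker : LinearMap.ker φ = cyclicCode n g := by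
    ext c
    rw [mem_cyclicCode_iff hg, LinearMap.mem_ker]
    exact AdjoinRoot.mk_eq_zero
  have hrange : LinearMap.range φ = ⊤ := by
    rw [LinearMap.range_eq_top]
    intro y
    obtain ⟨p, rfl⟩ := AdjoinRoot.mk_surjective y
    have hlt : (p % g).natDegree < n := by
      rcases eq_or_ne (p % g) 0 with h0 | h0
      · rw [h0, natDegree_zero]; exact hn
      · exact (natDegree_lt_natDegree h0 (degree_mod_lt p hg0)).trans_le hdeg
    obtain ⟨c, hc⟩ := exists_vecPoly_eq hlt
    refine ⟨c, ?_⟩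
    change AdjoinRoot.mk g (vecPoly F n c) = _
    rw [hc, AdjoinRoot.mk_eq_mk]
    exact (EuclideanDomain.mod_eq_sub_mul_div p g) ▸ ⟨-(p / g), by ring⟩
  have h := LinearMap.finrank_range_add_finrank_ker φ
  rw [hker, hrange, finrank_top, Module.finrank_fin_fun,
    (AdjoinRoot.powerBasis hg0).finrank, AdjoinRoot.powerBasis_dim] at h
  omega

end CyclicCodes

section BCH

variable {F : Type*} [Field F] {K : Type*} [Field K] [Algebra F K]

lemma bchGenerator_one_dvd_iff {β : K} {δ : ℕ} {p : F[X]} :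
    bchGenerator F β δ 1 ∣ p ↔ ∀ k, 1 ≤ k → k < δ → aeval (β ^ k) p = 0 := by
  classical
  let : NormalizedGCDMonoid F[X] := UniqueFactorizationMonoid.toNormalizedGCDMonoid F[X]
  have h : bchGenerator F β δ 1 ∣ p ↔ ∀ k ∈ Finset.Icc 1 (1 + δ - 2), minpoly F (β ^ k) ∣ p :=
    Finset.lcm_dvd_iff
  simp only [h, Finset.mem_Icc, minpoly.dvd_iff]
  exact ⟨fun h k h1 h2 => h k ⟨h1, by omega⟩, fun h k hk => h k hk.1 (by omega)⟩

lemma bchGenerator_dvd {β : K} {n : ℕ} (hβ : β ^ n = 1) (δ : ℕ) :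
    bchGenerator F β δ 1 ∣ X ^ n - 1 := by
  rw [bchGenerator_one_dvd_iff]
  intro k _ _
  simp [← pow_mul, mul_comm k n, pow_mul β n, hβ]

lemma mem_bchCode_iff {β : K} {n δ : ℕ} (hβ : β ^ n = 1) (c : Fin n → F) :
    c ∈ bchCode F β n δ 1 ↔
      ∀ k, 1 ≤ k → k < δ → ∑ j : Fin n, algebraMap F K (c j) * (β ^ (j : ℕ)) ^ k = 0 := by
  rw [bchCode, mem_cyclicCode_iff (bchGenerator_dvd hβ δ), bchGenerator_one_dvd_iff]
  simp only [vecPoly_apply, map_sum, aeval_monomial, ← pow_mul, mul_comm]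

/-- The BCH bound: a codeword orthogonal to all polynomials of degree less than `δ` without
constant term has at least `δ` nonzero coordinates. -/
lemma le_hammingNorm_of_mem_bchCode {β : K} {n δ : ℕ} (hβ : IsPrimitiveRoot β n) (hn : 1 ≤ n)
    {c : Fin n → F} (hc : c ∈ bchCode F β n δ 1) (h0 : c ≠ 0) [DecidableEq F] :
    δ ≤ hammingNorm c := by
  classical
  by_contra! hlt
  have hc' := (mem_bchCode_iff hβ.pow_eq_one c).1 hc
  obtain ⟨i, hi⟩ := Function.ne_iff.1 h0
  set S : Finset (Fin n) := Finset.univ.filter fun j => c j ≠ 0 with hS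
  have hiS : i ∈ S := by simpa [hS] using hi
  -- a polynomial without constant term that vanishes at all other locators
  set P : K[X] := X * ∏ j ∈ S.erase i, (X - C (β ^ (j : ℕ))) with hP
  have hdeg : P.natDegree < δ := by
    have h1 : (∏ j ∈ S.erase i, (X - C (β ^ (j : ℕ)))).natDegree = (S.erase i).card := by
      rw [natDegree_prod_of_monic _ _ fun j _ => monic_X_sub_C _]
      simp only [natDegree_X_sub_C, Finset.sum_const, smul_eq_mul, mul_one]
    have h2 : P.natDegree = (S.erase i).card + 1 := by
      rw [hP, natDegree_X_mul (Monic.ne_zero (monic_prod_of_monic _ _ fun j _ =>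
        monic_X_sub_C _)), h1]
    rw [h2, Finset.card_erase_add_one hiS]
    exact hlt
  have hP0 : P.coeff 0 = 0 := by simp [hP]
  have hsum : ∑ j : Fin n, algebraMap F K (c j) * P.eval (β ^ (j : ℕ)) = 0 := by
    have : ∀ x, P.eval x = ∑ k ∈ Finset.range δ, P.coeff k * x ^ k := fun x =>
      eval_eq_sum_range' hdeg x
    simp only [this, Finset.mul_sum]
    rw [Finset.sum_comm]
    refine Finset.sum_eq_zero fun k hk => ?_
    rcases Nat.eq_zero_or_pos k with rfl | hk0
    · simp [hP0]
    · have := hc' k hk0 (Finset.mem_range.1 hk)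
      calc _ = P.coeff k * ∑ j : Fin n, algebraMap F K (c j) * (β ^ (j : ℕ)) ^ k := by
            rw [Finset.mul_sum]
            exact Finset.sum_congr rfl fun j _ => by ring
        _ = 0 := by rw [this, mul_zero]
  rw [Finset.sum_eq_single i] at hsum
  · rcases mul_eq_zero.1 hsum with h | h
    · exact hi (by simpa using h)
    · have hβ0 : β ≠ 0 := hβ.ne_zero (by omega)
      rw [hP, eval_mul, eval_X, eval_prod, mul_eq_zero, Finset.prod_eq_zero_iff] at h
      rcases h with h | ⟨j, hj, h⟩
      · exact pow_ne_zero _ hβ0 h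
      · rw [eval_sub, eval_X, eval_C, sub_eq_zero] at h
        have := hβ.pow_inj i.2 j.2 h
        exact (Finset.mem_erase.1 hj).1 (Fin.ext this.symm)
  · intro j _ hji
    by_cases hj : c j = 0
    · simp [hj]
    · have hjS : j ∈ S.erase i := Finset.mem_erase.2 ⟨hji, by simpa [hS] using hj⟩
      rw [hP, eval_mul, eval_prod, Finset.prod_eq_zero hjS (by simp)]
      simp
  · simp

end BCH

section Dimension

variable {F : Type*} [Field F] [Fintype F] {K : Type*} [Field K] [Fintype K] [Algebra F K]

lemma aeval_minpoly_eq_zero_iff_exists_pow {x y : K} :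
    aeval x (minpoly F y) = 0 ↔ ∃ j : ℕ, x = y ^ Fintype.card F ^ j := by
  rw [← isConjRoot_iff_aeval_eq_zero (Algebra.IsIntegral.isIntegral y),
    IsConjRoot.comm, isConjRoot_iff_exists_algEquiv]
  constructor
  · rintro ⟨σ, rfl⟩
    obtain ⟨j, rfl⟩ := (FiniteField.bijective_frobeniusAlgEquivOfAlgebraic_pow F K).2 σ
    exact ⟨j, by
      simp [AlgEquiv.coe_pow, FiniteField.coe_frobeniusAlgEquivOfAlgebraic_iterate]⟩
  · rintro ⟨j, rfl⟩
    refine ⟨FiniteField.frobeniusAlgEquivOfAlgebraic F K ^ j, by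
      simp [AlgEquiv.coe_pow, FiniteField.coe_frobeniusAlgEquivOfAlgebraic_iterate]⟩

open Classical in
/-- The dimension is `n` minus the number of roots of the generator, which are the `α ^ s` with `s`
conjugate to one of `1, …, δ - 1`. -/
lemma finrank_bchCode {α : K} {n : ℕ} (hα : IsPrimitiveRoot α n) (hn : (n : F) ≠ 0) (δ : ℕ) :
    Module.finrank F (bchCode F α n δ 1) =
      ((Finset.range n).filter fun s => ∀ k j, 1 ≤ k → k < δ →
        ¬ s ≡ k * Fintype.card F ^ j [MOD n]).card := by
  have hn1 : 1 ≤ n := Nat.one_le_iff_ne_zero.2 fun h => hn (by simp [h])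
  have hdvd := bchGenerator_dvd (F := F) hα.pow_eq_one δ
  have h := finrank_cyclicCode hn1 hdvd
  have hsep : (bchGenerator F α δ 1).Separable := (X_pow_sub_one_separable_iff.2 hn).of_dvd hdvd
  have hsplit : ((bchGenerator F α δ 1).map (algebraMap F K)).Splits := by
    have h1 : (X ^ n - 1 : K[X]).Splits := X_pow_sub_one_splits hα
    refine h1.of_dvd (X_pow_sub_C_ne_zero hn1 1) ?_
    simpa using Polynomial.map_dvd (algebraMap F K) hdvd
  have hroot : ∀ x : K, aeval x (bchGenerator F α δ 1) = 0 ↔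
      ∃ k j, 1 ≤ k ∧ k < δ ∧ x = (α ^ k) ^ Fintype.card F ^ j := by
    intro x
    constructor
    · intro hx
      have h1 : bchGenerator F α δ 1 ∣ ∏ k ∈ Finset.Ico 1 δ, minpoly F (α ^ k) := by
        rw [bchGenerator_one_dvd_iff]
        intro k hk1 hk
        rw [map_prod]
        exact Finset.prod_eq_zero (Finset.mem_Ico.2 ⟨hk1, hk⟩) (minpoly.aeval _ _)
      have h2 := aeval_eq_zero_of_dvd_aeval_eq_zero h1 hx
      rw [map_prod, Finset.prod_eq_zero_iff] at h2
      obtain ⟨k, hk, h2⟩ := h2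
      obtain ⟨j, hj⟩ := aeval_minpoly_eq_zero_iff_exists_pow.1 h2
      exact ⟨k, j, (Finset.mem_Ico.1 hk).1, (Finset.mem_Ico.1 hk).2, hj⟩
    · rintro ⟨k, j, hk1, hk, rfl⟩
      have h1 : minpoly F (α ^ k) ∣ bchGenerator F α δ 1 :=
        minpoly.dvd_iff.2 (bchGenerator_one_dvd_iff.1 dvd_rfl k hk1 hk)
      exact aeval_eq_zero_of_dvd_aeval_eq_zero h1 (aeval_minpoly_eq_zero_iff_exists_pow.2 ⟨j, rfl⟩)
  have hpow : ∀ s t : ℕ, α ^ s = α ^ t ↔ s ≡ t [MOD n] := by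
    intro s t
    have hfin : IsOfFinOrder α := isOfFinOrder_iff_pow_eq_one.2 ⟨n, hn1, hα.pow_eq_one⟩
    rw [hα.eq_orderOf, hfin.pow_eq_pow_iff_modEq]
  have hcard := card_rootSet_eq_natDegree hsep hsplit
  have hset : (bchGenerator F α δ 1).rootSet K = (((Finset.range n).filter fun s =>
      ¬ ∀ k j, 1 ≤ k → k < δ → ¬ s ≡ k * Fintype.card F ^ j [MOD n]).image
        fun s => α ^ s : Finset K) := by
    ext x
    rw [mem_rootSet_of_ne hsep.ne_zero, hroot]
    simp only [Finset.coe_image, Set.mem_image, Finset.mem_coe, Finset.mem_filter,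
      Finset.mem_range]
    push Not
    constructor
    · rintro ⟨k, j, hk1, hk, rfl⟩
      refine ⟨k * Fintype.card F ^ j % n, ⟨Nat.mod_lt _ hn1, k, j, hk1, hk, Nat.mod_modEq _ _⟩, ?_⟩
      rw [← pow_mul]
      exact (hpow _ _).2 (Nat.mod_modEq _ _)
    · rintro ⟨s, ⟨-, k, j, hk1, hk, hs⟩, rfl⟩
      refine ⟨k, j, hk1, hk, ?_⟩
      rw [← pow_mul]
      exact (hpow _ _).2 hs
  have hcard2 : ((Finset.range n).filter fun s =>
      ¬ ∀ k j, 1 ≤ k → k < δ → ¬ s ≡ k * Fintype.card F ^ j [MOD n]).card =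
      (bchGenerator F α δ 1).natDegree := by
    rw [← hcard, Set.fintypeCard_eq_ncard, hset, Set.ncard_coe_finset, Finset.card_image_of_injOn]
    intro s hs s' hs' hss
    exact hα.pow_inj (Finset.mem_range.1 (Finset.mem_filter.1 hs).1)
      (Finset.mem_range.1 (Finset.mem_filter.1 hs').1) hss
  have := Finset.card_filter_add_card_filter_not (s := Finset.range n)
    (fun s => ∀ k j, 1 ≤ k → k < δ → ¬ s ≡ k * Fintype.card F ^ j [MOD n])
  rw [Finset.card_range] at this
  rw [bchCode]
  omega

end Dimension

/-! ### Totally singular subspaces and equidistribution on their cosets -/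

section QuadraticForms

variable {F : Type*} [Field F] {V : Type*} [AddCommGroup V] [Module F V]

/-- The orthogonal space of `I` for the polarization `β x y + β y x` of the quadratic form
`x ↦ β x x`. -/
noncomputable def polarPerp (β : LinearMap.BilinForm F V) (I : Submodule F V) : Submodule F V :=
  LinearMap.ker ((LinearMap.lcomp F F I.subtype) ∘ₗ (β + β.flip))

lemma mem_polarPerp {β : LinearMap.BilinForm F V} {I : Submodule F V} {y : V} :
    y ∈ polarPerp β I ↔ ∀ x ∈ I, β y x + β x y = 0 := by
  rw [polarPerp, LinearMap.mem_ker, LinearMap.ext_iff]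
  simp

variable {β : LinearMap.BilinForm F V} {I : Submodule F V}

lemma le_polarPerp (hI : ∀ x ∈ I, β x x = 0) : I ≤ polarPerp β I := by
  intro y hy
  rw [mem_polarPerp]
  intro x hx
  have := hI _ (I.add_mem hy hx)
  simpa [map_add, LinearMap.add_apply, hI x hx, hI y hy, add_comm] using this

lemma finrank_le_finrank_polarPerp_add [FiniteDimensional F V] :
    Module.finrank F V ≤ Module.finrank F (polarPerp β I) + Module.finrank F I := by
  have h := LinearMap.finrank_range_add_finrank_ker
    ((LinearMap.lcomp F F I.subtype) ∘ₗ (β + β.flip))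
  have h1 := Submodule.finrank_le
    (LinearMap.range ((LinearMap.lcomp F F I.subtype) ∘ₗ (β + β.flip)))
  have h2 : Module.finrank F (I →ₗ[F] F) = Module.finrank F I := Subspace.dual_finrank_eq
  rw [polarPerp]
  omega

lemma finrank_polarPerp_add [FiniteDimensional F V] (hI : ∀ x ∈ I, β x x = 0)
    (hβ : ∀ x, β x x = 0 → (∀ y, β y x + β x y = 0) → x = 0) :
    Module.finrank F (polarPerp β I) + Module.finrank F I = Module.finrank F V := by
  have h := LinearMap.finrank_range_add_finrank_ker
    ((LinearMap.lcomp F F I.subtype) ∘ₗ (β + β.flip))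
  have h1 : LinearMap.range ((LinearMap.lcomp F F I.subtype) ∘ₗ (β + β.flip)) = ⊤ := by
    let ψ : I →ₗ[F] Module.Dual F V := (β + β.flip) ∘ₗ I.subtype
    have hψ : Function.Injective ψ := by
      rw [injective_iff_map_eq_zero]
      intro x hx
      refine Subtype.ext (hβ x (hI x x.2) fun y => ?_)
      have := LinearMap.congr_fun hx y
      simpa [ψ, add_comm] using this
    rw [LinearMap.range_eq_top]
    intro ℓ
    obtain ⟨Φ, hΦ⟩ := (LinearMap.dualMap_surjective_iff.2 hψ) ℓ
    obtain ⟨y, rfl⟩ := (Module.evalEquiv F V).surjective Φ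
    refine ⟨y, ?_⟩
    rw [← hΦ]
    ext x
    simp [ψ, add_comm]
  have h2 : Module.finrank F (I →ₗ[F] F) = Module.finrank F I := Subspace.dual_finrank_eq
  rw [h1, finrank_top] at h
  rw [polarPerp]
  omega

/-- By Chevalley–Warning, a quadratic form in at least three variables over a finite field has a
nontrivial zero. -/
lemma exists_ne_zero_singular [Finite F] [FiniteDimensional F V] (β : LinearMap.BilinForm F V)
    (W : Submodule F V) (hW : 3 ≤ Module.finrank F W) : ∃ x ∈ W, x ≠ 0 ∧ β x x = 0 := by
  classical
  have := Fintype.ofFinite F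
  obtain ⟨p, hp⟩ := CharP.exists F
  let b := Module.finBasis F W
  let f : MvPolynomial (Fin (Module.finrank F W)) F :=
    ∑ i, ∑ j, MvPolynomial.C (β (b i) (b j)) * (MvPolynomial.X i * MvPolynomial.X j)
  have hdeg : f.totalDegree ≤ 2 := by
    refine MvPolynomial.totalDegree_finsetSum_le fun i _ =>
      MvPolynomial.totalDegree_finsetSum_le fun j _ => ?_
    refine (MvPolynomial.totalDegree_mul _ _).trans ?_
    refine (add_le_add le_rfl (MvPolynomial.totalDegree_mul _ _)).trans ?_
    simp
  have heval : ∀ x, MvPolynomial.eval x f = β (∑ i, x i • (b i : V)) (∑ i, x i • (b i : V)) := by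
    intro x
    simp only [f, map_sum, map_mul, MvPolynomial.eval_C, MvPolynomial.eval_X,
      LinearMap.sum_apply, map_smul, LinearMap.smul_apply, smul_eq_mul]
    rw [Finset.sum_comm]
    refine Finset.sum_congr rfl fun i _ => ?_
    rw [Finset.mul_sum]
    exact Finset.sum_congr rfl fun j _ => by ring
  have hdvd := char_dvd_card_solutions p (f := f) (by rw [Fintype.card_fin]; omega)
  have hp2 : p.Prime := (CharP.char_is_prime_or_zero F p).resolve_right
    (CharP.char_ne_zero_of_finite F p)
  have h0 : MvPolynomial.eval 0 f = 0 := by rw [heval]; simp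
  have hcard : 1 < Fintype.card {x // MvPolynomial.eval x f = 0} :=
    hp2.one_lt.trans_le (Nat.le_of_dvd (Fintype.card_pos_iff.2 ⟨⟨0, h0⟩⟩) hdvd)
  obtain ⟨⟨x, hx⟩, hx0⟩ := Fintype.exists_ne_of_one_lt_card hcard ⟨0, h0⟩
  rw [heval] at hx
  refine ⟨_, W.sum_mem fun i _ => W.smul_mem (x i) (b i).2, fun h => hx0 ?_, hx⟩
  have h1 : ∑ i, x i • b i = 0 := Subtype.ext (by simpa using h)
  exact Subtype.ext (funext fun i => Fintype.linearIndependent_iff.1 b.linearIndependent x h1 i)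

lemma singular_sup_span (hI : ∀ x ∈ I, β x x = 0) {w : V} (hw : w ∈ polarPerp β I)
    (hw0 : β w w = 0) : ∀ x ∈ I ⊔ Submodule.span F {w}, β x x = 0 := by
  intro x hx
  obtain ⟨y, hy, z, hz, rfl⟩ := Submodule.mem_sup.1 hx
  obtain ⟨c, rfl⟩ := Submodule.mem_span_singleton.1 hz
  have h1 := mem_polarPerp.1 hw y hy
  simp only [map_add, map_smul, LinearMap.add_apply, LinearMap.smul_apply, smul_eq_mul, hI y hy,
    hw0]
  linear_combination c * h1

lemma finrank_sup_span_singleton [FiniteDimensional F V] {w : V} (hw : w ∉ I) :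
    Module.finrank F (I ⊔ Submodule.span F {w} : Submodule F V) = Module.finrank F I + 1 := by
  have h0 : w ≠ 0 := fun h => hw (h ▸ I.zero_mem)
  have h := Submodule.finrank_sup_add_finrank_inf_eq I (Submodule.span F {w})
  have h1 : I ⊓ Submodule.span F {w} = ⊥ := by
    rw [← disjoint_iff, Submodule.disjoint_span_singleton' h0]
    exact hw
  rw [h1, finrank_bot, finrank_span_singleton h0] at h
  exact h

/-- Totally singular subspaces exist in every dimension `k` with `2 * k + 1 ≤ dim V`. -/
lemma exists_singular_subspace [Finite F] [FiniteDimensional F V] (β : LinearMap.BilinForm F V)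
    (k : ℕ) (hk : 2 * k + 1 ≤ Module.finrank F V) :
    ∃ I : Submodule F V, Module.finrank F I = k ∧ ∀ x ∈ I, β x x = 0 := by
  induction k with
  | zero => exact ⟨⊥, finrank_bot F V, fun x hx => by simp [(Submodule.mem_bot F).1 hx]⟩
  | succ k ih =>
    obtain ⟨I, hIk, hI⟩ := ih (by omega)
    obtain ⟨W, hW⟩ := I.exists_isCompl
    have h1 := finrank_le_finrank_polarPerp_add (β := β) (I := I)
    have h2 := Submodule.finrank_add_eq_of_isCompl hW
    have h3 := Submodule.finrank_sup_add_finrank_inf_eq (polarPerp β I) W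
    have h4 := Submodule.finrank_le (polarPerp β I ⊔ W)
    obtain ⟨w, hw, hw0, hww⟩ := exists_ne_zero_singular β (polarPerp β I ⊓ W) (by omega)
    have hwI : w ∉ I := fun h => hw0 (Submodule.disjoint_def.1 hW.disjoint w h hw.2)
    exact ⟨I ⊔ Submodule.span F {w}, by rw [finrank_sup_span_singleton hwI, hIk],
      singular_sup_span hI hw.1 hww⟩

lemma exists_le_finrank_eq [FiniteDimensional F V] (J : Submodule F V) {a : ℕ}
    (ha : a ≤ Module.finrank F J) : ∃ I ≤ J, Module.finrank F I = a := by
  let b := Module.finBasis F J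
  let v : Fin a → V := fun i => b (Fin.castLE ha i)
  have hv : LinearIndependent F v :=
    (b.linearIndependent.comp _ (Fin.castLE_injective ha)).map' J.subtype J.ker_subtype
  exact ⟨Submodule.span F (Set.range v), Submodule.span_le.2 (by rintro _ ⟨i, rfl⟩; exact (b _).2),
    by rw [finrank_span_eq_card hv, Fintype.card_fin]⟩

end QuadraticForms

section Counting

open Finset

variable {F : Type*} [Field F] [Fintype F] {V : Type*} [AddCommGroup V] [Module F V]

open Classical in
lemma card_functional_fiber {W : Type*} [AddCommGroup W] [Module F W] [Fintype W]
    (ℓ : W →ₗ[F] F) (hℓ : ℓ ≠ 0) (c : F) :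
    Fintype.card F * (univ.filter fun x => ℓ x = c).card = Fintype.card W := by
  have hsurj : Function.Surjective ℓ := LinearMap.surjective hℓ
  have h : ∀ d, (univ.filter fun x => ℓ x = d).card = (univ.filter fun x => ℓ x = c).card := by
    intro d
    obtain ⟨w, hw⟩ := hsurj (d - c)
    refine card_bij (fun x _ => x - w) ?_ ?_ ?_
    · intro x hx
      simp only [mem_filter, mem_univ, true_and] at hx ⊢
      rw [map_sub, hx, hw, sub_sub_cancel]
    · intro x _ y _ hxy
      exact sub_left_injective hxy
    · intro x hx
      simp only [mem_filter, mem_univ, true_and] at hx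
      exact ⟨x + w, by simp [hx, hw], by simp⟩
  have h1 := card_eq_sum_card_fiberwise (f := ℓ) (s := univ) (t := univ) (fun x _ => mem_univ _)
  rw [← card_univ (α := W), h1, sum_congr rfl fun d _ => h d, sum_const, card_univ, smul_eq_mul]

open Classical in
/-- A function `g` on `V` that varies on the cosets of a totally singular subspace `I` like the
polarization is equidistributed on each coset outside `polarPerp β I`. -/
lemma card_zeros_eq [Fintype V] {β : LinearMap.BilinForm F V} {I : Submodule F V}
    (hI : ∀ x ∈ I, β x x = 0) (g : V → F)
    (hg : ∀ y, ∀ x ∈ I, g (y + x) = g y + (β y x + β x y)) :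
    Fintype.card F * (univ.filter fun y => g y = 0).card + Fintype.card (polarPerp β I) =
      Fintype.card F * (univ.filter fun y => y ∈ polarPerp β I ∧ g y = 0).card +
        Fintype.card V := by
  set O := polarPerp β I with hO
  have hIperp : I ≤ O := le_polarPerp hI
  set q := Fintype.card F with hq
  have hI0 : 0 < Fintype.card I := Fintype.card_pos
  -- count the pairs `(y, x)` with `y ∉ O`, `x ∈ I` and `g (y + x) = 0` in two ways
  have key : q * (univ.filter fun y => y ∉ O ∧ g y = 0).card =
      (univ.filter fun y => y ∉ O).card := by
    have h1 : ∀ x : I, (univ.filter fun y => y ∉ O ∧ g (y + x) = 0).card =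
        (univ.filter fun y => y ∉ O ∧ g y = 0).card := by
      intro x
      have hx : ∀ y, y + (x : V) ∈ O ↔ y ∈ O := fun y => O.add_mem_iff_left (hIperp x.2)
      refine card_bij (fun y _ => y + x) ?_ ?_ ?_
      · intro y hy
        simpa [hx] using hy
      · intro y _ z _ h
        exact add_left_injective _ h
      · intro y hy
        refine ⟨y - x, ?_, by simp⟩
        rw [mem_filter, ← hx]
        simpa using hy
    have h2 : ∀ y, y ∉ O → q * (univ.filter fun x : I => g (y + x) = 0).card =
        Fintype.card I := by
      intro y hy
      have hℓ : ((LinearMap.lcomp F F I.subtype) ∘ₗ (β + β.flip)) y ≠ 0 := fun h => hy h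
      rw [← card_functional_fiber _ hℓ (-g y)]
      congr 2
      ext x
      simp only [mem_filter, mem_univ, true_and]
      rw [hg y x x.2, eq_neg_iff_add_eq_zero, add_comm]
      simp
    have h3 : Fintype.card I * (univ.filter fun y => y ∉ O ∧ g y = 0).card =
        ∑ y ∈ univ.filter (fun y => y ∉ O), (univ.filter fun x : I => g (y + x) = 0).card := by
      rw [← card_univ (α := I), ← smul_eq_mul, ← sum_const, ← sum_congr rfl fun x _ => h1 x]
      simp only [card_filter, ite_and]
      rw [sum_comm, sum_filter]
      refine sum_congr rfl fun y _ => ?_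
      split_ifs <;> simp
    have h4 : Fintype.card I * (q * (univ.filter fun y => y ∉ O ∧ g y = 0).card) =
        Fintype.card I * (univ.filter fun y => y ∉ O).card := by
      rw [mul_left_comm, h3, mul_sum,
        sum_congr rfl fun y hy => h2 y (mem_filter.1 hy).2, sum_const, smul_eq_mul, mul_comm]
    exact Nat.eq_of_mul_eq_mul_left hI0 h4
  have e1 : (univ.filter fun y => y ∈ O ∧ g y = 0).card +
      (univ.filter fun y => y ∉ O ∧ g y = 0).card = (univ.filter fun y => g y = 0).card := by
    rw [← card_filter_add_card_filter_not (s := univ.filter fun y => g y = 0) (fun y => y ∈ O)]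
    simp only [filter_filter, and_comm]
  have e2 : Fintype.card O + (univ.filter fun y => y ∉ O).card = Fintype.card V := by
    rw [Fintype.card_subtype, card_filter_add_card_filter_not, card_univ]
  rw [← e1, ← e2, ← key]
  ring

end Counting

/-! ### Counting zeros on orthogonal spaces of totally singular subspaces -/

section QuadricSections

open Finset

variable {F : Type*} [Field F] [Fintype F] {V : Type*} [AddCommGroup V] [Module F V]

lemma card_submodule [FiniteDimensional F V] (W : Submodule F V) [Fintype W] :
    Fintype.card W = Fintype.card F ^ Module.finrank F W :=
  Module.card_eq_pow_finrank

variable [Fintype V]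

open Classical in
/-- In even dimension, the zeros of `β y y + c` on the orthogonal space of a totally singular
subspace are counted once all of them are. -/
lemma exists_singular_card_zeros_of_even {β : LinearMap.BilinForm F V} {c : F} {a s : ℕ}
    (hV : Module.finrank F V = 2 * s) (has : a + 1 ≤ s)
    (hβ : ∀ x, β x x = 0 → (∀ y, β y x + β x y = 0) → x = 0)
    (hc : (univ.filter fun y => β y y + c = 0).card =
      Fintype.card F ^ (2 * s - 1) + Fintype.card F ^ (s - 1)) :
    ∃ I : Submodule F V, Module.finrank F I = a ∧ (∀ x ∈ I, β x x = 0) ∧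
      Module.finrank F (polarPerp β I) = 2 * s - a ∧
      (univ.filter fun y => y ∈ polarPerp β I ∧ β y y + c = 0).card =
        Fintype.card F ^ (2 * s - a - 1) + Fintype.card F ^ (s - 1) := by
  have : FiniteDimensional F V := FiniteDimensional.of_finrank_pos (by omega)
  obtain ⟨I, hIa, hI⟩ := exists_singular_subspace β a (by omega)
  have hperp := finrank_polarPerp_add hI hβ
  refine ⟨I, hIa, hI, by omega, ?_⟩
  have h := card_zeros_eq hI (fun y => β y y + c) (by
    intro y x hx
    simp only [map_add, LinearMap.add_apply, hI x hx]
    ring)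
  rw [card_submodule, hc, Module.card_eq_pow_finrank (K := F) (V := V), hV,
    show Module.finrank F (polarPerp β I) = 2 * s - a - 1 + 1 by omega,
    show 2 * s = 2 * s - 1 + 1 by omega, pow_succ, pow_succ] at h
  simp only [Nat.add_sub_cancel] at h
  rw [show 2 * s - 1 + 1 - a - 1 = 2 * s - a - 1 by omega] at h
  refine Nat.eq_of_mul_eq_mul_left (Fintype.card_pos (α := F)) ?_
  linarith

open Classical in
/-- In odd dimension `2 * n + 1`, a maximal totally singular subspace `J` has an orthogonal space
`J ⊕ F w`, on which a suitable `β y y + L y` becomes `λ t (t - 1)` in the coordinate `t` along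
`w`. This determines the number of zeros of `β y y + L y` everywhere, and hence on the orthogonal
spaces of the subspaces of `J`. -/
lemma exists_singular_card_zeros_of_odd {β : LinearMap.BilinForm F V} {a n : ℕ}
    (hV : Module.finrank F V = 2 * n + 1) (han : a ≤ n)
    (hβ : ∀ x, β x x = 0 → (∀ y, β y x + β x y = 0) → x = 0) :
    ∃ (I : Submodule F V) (L : V →ₗ[F] F), Module.finrank F I = a ∧ (∀ x ∈ I, β x x = 0) ∧
      Module.finrank F (polarPerp β I) = 2 * n + 1 - a ∧
      (univ.filter fun y => y ∈ polarPerp β I ∧ β y y + L y = 0).card =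
        Fintype.card F ^ (2 * n - a) + Fintype.card F ^ n := by
  have : FiniteDimensional F V := FiniteDimensional.of_finrank_pos (by omega)
  set q := Fintype.card F with hq
  have hq0 : 0 < q := Fintype.card_pos
  obtain ⟨J, hJn, hJ⟩ := exists_singular_subspace β n (by omega)
  obtain ⟨I, hIJ, hIa⟩ := exists_le_finrank_eq J (a := a) (by omega)
  have hI : ∀ x ∈ I, β x x = 0 := fun x hx => hJ x (hIJ hx)
  have hJp := finrank_polarPerp_add hJ hβ
  have hIp := finrank_polarPerp_add hI hβ
  obtain ⟨w, hw, hwJ⟩ : ∃ w ∈ polarPerp β J, w ∉ J := by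
    by_contra! h
    have := Submodule.finrank_mono (show polarPerp β J ≤ J from h)
    omega
  have hsup := finrank_sup_span_singleton hwJ
  -- a singular `w` would give a totally singular subspace larger than its orthogonal space
  have hww : β w w ≠ 0 := by
    intro h0
    have h1 := singular_sup_span hJ hw h0
    have h2 := finrank_polarPerp_add h1 hβ
    have h3 := Submodule.finrank_mono (le_polarPerp h1)
    omega
  have hJw : J ⊔ Submodule.span F {w} = polarPerp β J := by
    refine Submodule.eq_of_le_of_finrank_eq (sup_le (le_polarPerp hJ) ?_) (by omega)
    rwa [Submodule.span_singleton_le_iff_mem]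
  obtain ⟨L₁, hL₁w, hL₁J⟩ : ∃ L₁ : V →ₗ[F] F, L₁ w = 1 ∧ ∀ x ∈ J, L₁ x = 0 := by
    obtain ⟨L₀, hL₀w, hL₀J⟩ := Submodule.exists_le_ker_of_notMem hwJ
    refine ⟨(L₀ w)⁻¹ • L₀, by simp [hL₀w], fun x hx => ?_⟩
    have : L₀ x = 0 := hL₀J hx
    simp [this]
  have hsq : ∀ y ∈ polarPerp β J, β y y = β w w * (L₁ y * L₁ y) := by
    intro y hy
    rw [← hJw] at hy
    obtain ⟨x, hx, z, hz, rfl⟩ := Submodule.mem_sup.1 hy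
    obtain ⟨t, rfl⟩ := Submodule.mem_span_singleton.1 hz
    have h1 := mem_polarPerp.1 hw x hx
    simp only [map_add, map_smul, LinearMap.add_apply, LinearMap.smul_apply, smul_eq_mul,
      hJ x hx, hL₁J x hx, hL₁w]
    linear_combination t * h1
  set L : V →ₗ[F] F := -(β w w) • L₁ with hL
  have hLy : ∀ y, L y = -(β w w) * L₁ y := fun y => rfl
  have hLJ : ∀ x ∈ J, L x = 0 := fun x hx => by rw [hLy, hL₁J x hx, mul_zero]
  have hzero : (univ.filter fun y => y ∈ polarPerp β J ∧ β y y + L y = 0).card = 2 * q ^ n := by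
    have h1 : ∀ y ∈ polarPerp β J, (β y y + L y = 0 ↔ L₁ y = 0 ∨ L₁ y = 1) := by
      intro y hy
      have : β y y + L y = β w w * (L₁ y * (L₁ y - 1)) := by
        rw [hsq y hy, hLy]; ring
      rw [this, mul_eq_zero, mul_eq_zero, sub_eq_zero]
      simp [hww]
    have hℓ : L₁.domRestrict (polarPerp β J) ≠ 0 := by
      intro h
      have := LinearMap.congr_fun h ⟨w, hw⟩
      simp [hL₁w] at this
    have h2 : ∀ d, (univ.filter fun y : polarPerp β J => L₁ y = d).card = q ^ n := by
      intro d
      have h := card_functional_fiber _ hℓ d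
      rw [card_submodule, show Module.finrank F (polarPerp β J) = n + 1 by omega, pow_succ'] at h
      exact Nat.eq_of_mul_eq_mul_left hq0 h
    have h3 : (univ.filter fun y => y ∈ polarPerp β J ∧ β y y + L y = 0) =
        ((univ.filter fun y : polarPerp β J => L₁ y = 0) ∪
          (univ.filter fun y : polarPerp β J => L₁ y = 1)).map (Function.Embedding.subtype _) := by
      ext y
      simp only [mem_filter, mem_univ, true_and, mem_map, mem_union,
        Function.Embedding.coe_subtype, Subtype.exists, exists_and_right, exists_eq_right]
      constructor
      · rintro ⟨hy, h⟩
        exact ⟨hy, (h1 y hy).1 h⟩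
      · rintro ⟨hy, h⟩
        exact ⟨hy, (h1 y hy).2 h⟩
    rw [h3, card_map, card_union_of_disjoint, h2, h2, two_mul]
    rw [disjoint_filter]
    intro y _ hy0 hy1
    exact zero_ne_one (hy0.symm.trans hy1)
  have hvar : ∀ y, ∀ x ∈ J, β (y + x) (y + x) + L (y + x) = β y y + L y + (β y x + β x y) := by
    intro y x hx
    simp only [map_add, LinearMap.add_apply, hJ x hx, hLJ x hx]
    ring
  refine ⟨I, L, hIa, hI, by omega, ?_⟩
  have hcJ := card_zeros_eq hJ (fun y => β y y + L y) hvar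
  have hcI := card_zeros_eq hI (fun y => β y y + L y) fun y x hx => hvar y x (hIJ hx)
  rw [card_submodule, show Module.finrank F (polarPerp β J) = n + 1 by omega, hzero] at hcJ
  rw [card_submodule, show Module.finrank F (polarPerp β I) = 2 * n - a + 1 by omega] at hcI
  rw [← hq, pow_succ] at hcJ hcI
  refine Nat.eq_of_mul_eq_mul_left hq0 ?_
  linarith

end QuadricSections

/-! ### The forms `Tr (γ x y ^ (q ^ d))` -/

section FrobeniusForms

open Finset

variable (F : Type*) [Field F] [Fintype F] {K : Type*} [Field K] [Fintype K] [Algebra F K]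

/-- The `k`-th power `x ↦ x ^ (q ^ k)` of the `q`-Frobenius, as a linear map over `F = 𝔽_q`. -/
noncomputable def frobPow (K : Type*) [Field K] [Algebra F K] (k : ℕ) : K →ₗ[F] K :=
  (FiniteField.frobeniusAlgHom F K ^ k).toLinearMap

omit [Fintype K] in
@[simp]
lemma frobPow_apply (k : ℕ) (x : K) : frobPow F K k x = x ^ Fintype.card F ^ k := by
  simp [frobPow, AlgHom.coe_pow, FiniteField.coe_frobeniusAlgHom, pow_iterate]

lemma pow_pow_finrank (x : K) : x ^ Fintype.card F ^ Module.finrank F K = x := by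
  rw [← Module.card_eq_pow_finrank (K := F) (V := K)]
  exact FiniteField.pow_card x

lemma pow_pow_eq_of_modEq {u v : ℕ} (h : u ≡ v [MOD Module.finrank F K]) (x : K) :
    x ^ Fintype.card F ^ u = x ^ Fintype.card F ^ v := by
  have key : ∀ w, x ^ Fintype.card F ^ w = x ^ Fintype.card F ^ (w % Module.finrank F K) := by
    intro w
    have h1 : ∀ (l : ℕ) (y : K), y ^ (Fintype.card F ^ Module.finrank F K) ^ l = y := by
      intro l y
      induction l with
      | zero => simp
      | succ l ih => rw [pow_succ, pow_mul, ih, pow_pow_finrank]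
    conv_lhs => rw [← Nat.div_add_mod w (Module.finrank F K), pow_add, pow_mul, pow_mul, h1]
  rw [key u, key v, show u % _ = v % _ from h]

lemma trace_pow_pow (x : K) (k : ℕ) :
    Algebra.trace F K (x ^ Fintype.card F ^ k) = Algebra.trace F K x := by
  have := Algebra.trace_eq_of_algEquiv (FiniteField.frobeniusAlgEquivOfAlgebraic F K ^ k) x
  rwa [AlgEquiv.coe_pow, FiniteField.coe_frobeniusAlgEquivOfAlgebraic_iterate] at this

lemma eq_zero_of_forall_trace_mul {x : K} (h : ∀ y, Algebra.trace F K (y * x) = 0) : x = 0 :=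
  (traceForm_nondegenerate F K).2 x h

variable {F}

/-- The bilinear form `(x, y) ↦ Tr (γ x y ^ (q ^ d))`. -/
noncomputable def frobForm (γ : K) (d : ℕ) : LinearMap.BilinForm F K :=
  (Algebra.traceForm F K).compl₁₂ (LinearMap.mulLeft F γ) (frobPow F K d)

omit [Fintype K] in
lemma frobForm_apply (γ : K) (d : ℕ) (x y : K) :
    frobForm (F := F) γ d x y = Algebra.trace F K (γ * x * y ^ Fintype.card F ^ d) := by
  simp [frobForm]

/-- The polarization of `frobForm γ d` is `(y, x) ↦ Tr (y * frobAdj γ d x)`. -/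
noncomputable def frobAdj (γ : K) (d : ℕ) : K →ₗ[F] K :=
  LinearMap.mulLeft F γ ∘ₗ frobPow F K d +
    frobPow F K (Module.finrank F K - d) ∘ₗ LinearMap.mulLeft F γ

omit [Fintype K] in
lemma frobAdj_apply (γ : K) (d : ℕ) (x : K) :
    frobAdj (F := F) γ d x = γ * x ^ Fintype.card F ^ d +
      (γ * x) ^ Fintype.card F ^ (Module.finrank F K - d) := by
  simp [frobAdj]

lemma frobForm_polar {γ : K} {d : ℕ} (hd : d ≤ Module.finrank F K) (x y : K) :
    frobForm (F := F) γ d y x + frobForm (F := F) γ d x y =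
      Algebra.trace F K (y * frobAdj (F := F) γ d x) := by
  rw [frobForm_apply, frobForm_apply,
    ← trace_pow_pow F (γ * x * y ^ Fintype.card F ^ d) (Module.finrank F K - d), mul_pow, ← pow_mul,
    ← pow_add, Nat.add_sub_cancel' hd, pow_pow_finrank, ← map_add, frobAdj_apply]
  congr 1
  ring

/-- In odd degree `Tr (x ^ (q ^ n + 1))` is nondegenerate. In characteristic two the polarization
itself has the radical `F`, on which the form does not vanish. -/
lemma frobForm_one_nondegenerate_of_odd {n : ℕ} (hm : Module.finrank F K = 2 * n + 1) (x : K)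
    (hx : frobForm (F := F) 1 n x x = 0)
    (h : ∀ y, frobForm (F := F) 1 n y x + frobForm (F := F) 1 n x y = 0) : x = 0 := by
  have h1 : frobAdj (F := F) 1 n x = 0 := eq_zero_of_forall_trace_mul F fun y => by
    rw [← frobForm_polar (by omega), h]
  rw [frobAdj_apply, one_mul, one_mul, hm] at h1
  -- apply the Frobenius `n + 1` times
  have h2 : x ^ Fintype.card F = -x := by
    have h3 := congrArg (frobPow F K (n + 1)) h1
    rw [map_add, map_zero, frobPow_apply, frobPow_apply, ← pow_mul, ← pow_mul, ← pow_add,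
      ← pow_add, pow_pow_eq_of_modEq F (v := 0) (u := n + (n + 1))
        (by rw [hm, show n + (n + 1) = 2 * n + 1 by omega]; simp [Nat.ModEq]),
      pow_pow_eq_of_modEq F (v := 1) (u := 2 * n + 1 - n + (n + 1))
        (by rw [hm, show 2 * n + 1 - n + (n + 1) = (2 * n + 1) + 1 by omega]; simp [Nat.ModEq])]
      at h3
    rw [pow_zero, pow_one, pow_one] at h3
    linear_combination h3
  have h4 : ∀ k, x ^ Fintype.card F ^ k = (-1) ^ k * x := by
    intro k
    induction k with
    | zero => simp
    | succ k ih =>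
      have h5 := congrArg (frobPow F K 1) ih
      have h6 : frobPow F K 1 ((-1) ^ k * x) = (-1) ^ k * frobPow F K 1 x := by
        rcases neg_one_pow_eq_or K k with h | h <;> simp only [h, one_mul, neg_mul, map_neg]
      rw [h6, frobPow_apply, frobPow_apply, ← pow_mul, ← pow_add, pow_one, h2] at h5
      rw [h5]; ring
  have h7 : (2 : K) * x = 0 := by
    have := h4 (2 * n + 1)
    rw [← hm, pow_pow_finrank, hm, Odd.neg_one_pow ⟨n, rfl⟩] at this
    linear_combination this
  rcases mul_eq_zero.1 h7 with h8 | h8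
  · -- in characteristic two `x` is fixed by Frobenius, so the form takes the value `x ^ 2` at `x`
    have hneg : (-1 : K) = 1 := by linear_combination -h8
    have h9 : ∀ k, x ^ Fintype.card F ^ k = x := fun k => by rw [h4, hneg]; simp
    have h10 := congrArg (algebraMap F K) hx
    rw [frobForm_apply, FiniteField.algebraMap_trace_eq_sum_pow, one_mul, h9, map_zero,
      Nat.card_eq_fintype_card] at h10
    simp only [mul_pow, h9] at h10
    rw [sum_const, card_range, hm, nsmul_eq_mul] at h10
    push_cast at h10
    rw [h8] at h10
    simpa using h10
  · exact h8

lemma exists_add_pow_eq_one {s : ℕ} (hs : 1 ≤ s) (hm : Module.finrank F K = 2 * s) :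
    ∃ γ : K, γ + γ ^ Fintype.card F ^ s = 1 := by
  have hq : 1 < Fintype.card F := Fintype.one_lt_card
  obtain ⟨y, hy⟩ : ∃ y : K, y + y ^ Fintype.card F ^ s ≠ 0 := by
    by_contra! h
    have hlt : 1 < Fintype.card F ^ s := Nat.one_lt_pow (by omega) hq
    have hdeg : (X ^ Fintype.card F ^ s + X : K[X]).natDegree = Fintype.card F ^ s := by
      rw [natDegree_add_eq_left_of_natDegree_lt, natDegree_X_pow]
      rwa [natDegree_X_pow, natDegree_X]
    have h0 : (X ^ Fintype.card F ^ s + X : K[X]) ≠ 0 := by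
      intro h0
      rw [h0, natDegree_zero] at hdeg
      omega
    have h1 := card_le_degree_of_subset_roots (p := (X ^ Fintype.card F ^ s + X : K[X]))
      (Z := univ) (by
        intro y _
        rw [mem_roots h0, IsRoot.def]
        have := h y
        simpa [add_comm] using this)
    rw [hdeg, card_univ, Module.card_eq_pow_finrank (K := F), hm] at h1
    have h2 := (Nat.pow_le_pow_iff_right hq).1 h1
    omega
  refine ⟨y / (y + y ^ Fintype.card F ^ s), ?_⟩
  have h1 : (y + y ^ Fintype.card F ^ s) ^ Fintype.card F ^ s = y + y ^ Fintype.card F ^ s := by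
    have : frobPow F K s (y + frobPow F K s y) = y + frobPow F K s y := by
      rw [map_add]
      simp only [frobPow_apply]
      rw [← pow_mul, ← pow_add, show s + s = Module.finrank F K by omega, pow_pow_finrank, add_comm]
    simpa only [frobPow_apply] using this
  rw [div_pow, h1, ← add_div, div_self hy]

lemma frobForm_nondegenerate_of_even {s : ℕ} (hm : Module.finrank F K = 2 * s) {γ : K}
    (hγ : γ + γ ^ Fintype.card F ^ s = 1) (x : K)
    (h : ∀ y, frobForm (F := F) γ s y x + frobForm (F := F) γ s x y = 0) : x = 0 := by
  have h1 : frobAdj (F := F) γ s x = 0 := eq_zero_of_forall_trace_mul F fun y => by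
    rw [← frobForm_polar (by omega), h]
  rw [frobAdj_apply, hm, show 2 * s - s = s by omega, mul_pow, ← add_mul, hγ, one_mul] at h1
  exact eq_zero_of_pow_eq_zero h1

open Classical in
/-- In the cyclic group of order `b * c`, every `b`-th root of unity has exactly `c` roots of
order `c`. -/
lemma card_pow_eq {b c : ℕ} (hb : 1 ≤ b) (hc : 1 ≤ c) (hK : Fintype.card K = b * c + 1) {z : K}
    (hz0 : z ≠ 0) (hz : z ^ b = 1) : (univ.filter fun y : K => y ^ c = z).card = c := by
  obtain ⟨α, hα⟩ := IsCyclic.exists_generator (α := Kˣ)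
  have hord : orderOf α = b * c := by
    rw [orderOf_eq_card_of_forall_mem_zpowers hα, Nat.card_eq_fintype_card, Fintype.card_units, hK,
      Nat.add_sub_cancel]
  have hprim : IsPrimitiveRoot (α : K) (b * c) := by
    rw [← hord, ← orderOf_units]
    exact IsPrimitiveRoot.orderOf _
  have hex : ∃ y, y ^ c = z := by
    obtain ⟨j, hj⟩ := (mem_powers_iff_mem_zpowers (x := α)).2 (hα (Units.mk0 z hz0))
    have hj' : (α : K) ^ j = z := by simpa using congrArg Units.val hj
    rw [← hj', ← pow_mul, hprim.pow_eq_one_iff_dvd, mul_comm j] at hz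
    obtain ⟨i, rfl⟩ := Nat.dvd_of_mul_dvd_mul_left hb hz
    exact ⟨(α : K) ^ i, by rw [← hj', ← pow_mul, mul_comm]⟩
  have hprimc : IsPrimitiveRoot ((α : K) ^ b) c := hprim.pow (Nat.mul_pos hb hc) rfl
  have hset : (univ.filter fun y : K => y ^ c = z) = (nthRoots c z).toFinset := by
    ext y
    simp [mem_nthRoots hc]
  rw [hset, Multiset.toFinset_card_of_nodup (hprimc.nthRoots_nodup hz0), hprimc.card_nthRoots,
    if_pos hex]

open Classical in
/-- In the quadratic extension `K` of `M = 𝔽_{q^s}` the form `Tr (γ x ^ (q ^ s + 1))` is the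
norm to `M` followed by a nonzero functional on `M`, and all norm fibres over `M \ {0}` have
`q ^ s + 1` elements. -/
lemma card_frobForm_eq_one {s : ℕ} (hs : 1 ≤ s) (hm : Module.finrank F K = 2 * s) {γ : K}
    (hγ : γ + γ ^ Fintype.card F ^ s = 1) :
    (univ.filter fun y : K => frobForm (F := F) γ s y y + (-1) = 0).card =
      Fintype.card F ^ (2 * s - 1) + Fintype.card F ^ (s - 1) := by
  set q := Fintype.card F with hq
  have hq1 : 1 < q := Fintype.one_lt_card
  have hqs : 1 < q ^ s := Nat.one_lt_pow (by omega) hq1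
  have hK : Fintype.card K = (q ^ s - 1) * (q ^ s + 1) + 1 := by
    rw [Module.card_eq_pow_finrank (K := F), hm, ← hq, mul_comm 2 s, pow_mul]
    obtain ⟨t, ht⟩ : ∃ t, q ^ s = t + 1 := ⟨q ^ s - 1, by omega⟩
    rw [ht, Nat.add_sub_cancel]; ring
  let M : Submodule F K := LinearMap.ker (frobPow F K s - LinearMap.id)
  have hM : ∀ z, z ∈ M ↔ z ^ q ^ s = z := by
    intro z
    rw [LinearMap.mem_ker, LinearMap.sub_apply, frobPow_apply, LinearMap.id_apply, sub_eq_zero]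
  have hnorm : ∀ y : K, y ^ (q ^ s + 1) ∈ M := by
    intro y
    have h1 : y ^ (q ^ s * q ^ s) = y := by
      rw [← pow_add, show s + s = Module.finrank F K by omega, hq, pow_pow_finrank]
    rw [hM, ← pow_mul, add_mul, pow_add, h1, one_mul, pow_succ, mul_comm]
  have hfib : ∀ z ∈ M, z ≠ 0 → (univ.filter fun y : K => y ^ (q ^ s + 1) = z).card =
      q ^ s + 1 := by
    intro z hz hz0
    refine card_pow_eq (b := q ^ s - 1) (by omega) (by omega) hK hz0 ?_
    have h1 := (hM z).1 hz
    rw [← Nat.sub_add_cancel hqs.le, pow_succ] at h1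
    exact mul_right_cancel₀ hz0 (by rw [h1, one_mul])
  -- the norm fibres partition the nonzero elements of `K`
  have hMcard : Fintype.card M = q ^ s := by
    have h1 := card_eq_sum_card_fiberwise (f := fun y : K => y ^ (q ^ s + 1))
      (s := univ.filter fun y : K => y ≠ 0) (t := univ.filter fun z : K => z ∈ M ∧ z ≠ 0) (by
        intro y hy
        simp only [coe_filter, mem_univ, true_and, Set.mem_ofPred_eq] at hy ⊢
        exact ⟨hnorm y, pow_ne_zero _ hy⟩)
    have h2 : ∀ z ∈ univ.filter (fun z : K => z ∈ M ∧ z ≠ 0),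
        ((univ.filter fun y : K => y ≠ 0).filter fun y => y ^ (q ^ s + 1) = z).card =
          q ^ s + 1 := by
      intro z hz
      simp only [mem_filter, mem_univ, true_and] at hz
      rw [filter_filter]
      refine Eq.trans (congrArg card ?_) (hfib z hz.1 hz.2)
      ext y
      simp only [mem_filter, mem_univ, true_and, and_iff_right_iff_imp]
      rintro h rfl
      exact hz.2 (by rw [← h]; simp)
    rw [sum_congr rfl h2, sum_const, smul_eq_mul] at h1
    have h3 : (univ.filter fun y : K => y ≠ 0).card = (q ^ s - 1) * (q ^ s + 1) := by
      rw [filter_ne', card_erase_of_mem (mem_univ _), card_univ, hK, Nat.add_sub_cancel]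
    rw [h3] at h1
    have h4 := Nat.eq_of_mul_eq_mul_right (by omega) h1
    have h5 : (univ.filter fun z : K => z ∈ M ∧ z ≠ 0) =
        (univ.filter fun z : K => z ∈ M).erase 0 := by
      ext z; simp [and_comm]
    rw [h5, card_erase_of_mem (by simp)] at h4
    have h6 : (univ.filter fun z : K => z ∈ M).card = Fintype.card M :=
      (Fintype.card_subtype _).symm
    have h7 : 0 < Fintype.card M := Fintype.card_pos
    omega
  let ℓ : M →ₗ[F] F := (Algebra.trace F K ∘ₗ LinearMap.mulLeft F γ).domRestrict M
  have hform : ∀ y : K, frobForm (F := F) γ s y y = ℓ ⟨y ^ (q ^ s + 1), hnorm y⟩ := by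
    intro y
    rw [frobForm_apply]
    simp only [ℓ, LinearMap.domRestrict_apply, LinearMap.comp_apply, LinearMap.mulLeft_apply]
    congr 1
    rw [pow_succ, ← hq]; ring
  have hℓ : ℓ ≠ 0 := by
    intro h0
    have h1 : ∀ y : K, frobForm (F := F) γ s y y = 0 := fun y => by rw [hform, h0]; rfl
    refine one_ne_zero (frobForm_nondegenerate_of_even hm hγ (1 : K) fun y => ?_)
    have h2 := h1 (y + 1)
    simp only [map_add, LinearMap.add_apply, h1] at h2
    linear_combination h2
  have hfun := card_functional_fiber ℓ hℓ 1
  rw [hMcard, ← hq] at hfun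
  have h1 := card_eq_sum_card_fiberwise (f := fun y : K => (⟨y ^ (q ^ s + 1), hnorm y⟩ : M))
    (s := univ.filter fun y : K => frobForm (F := F) γ s y y + (-1) = 0)
    (t := univ.filter fun z : M => ℓ z = 1) (by
      intro y hy
      simp only [coe_filter, mem_univ, true_and, Set.mem_ofPred_eq] at hy ⊢
      rw [← hform]
      linear_combination hy)
  have h2 : ∀ z ∈ univ.filter (fun z : M => ℓ z = 1),
      ((univ.filter fun y : K => frobForm (F := F) γ s y y + (-1) = 0).filter
        fun y => (⟨y ^ (q ^ s + 1), hnorm y⟩ : M) = z).card = q ^ s + 1 := by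
    intro z hz
    simp only [mem_filter, mem_univ, true_and] at hz
    have hz0 : (z : K) ≠ 0 := by
      intro h0
      rw [show z = 0 from Subtype.ext h0, map_zero] at hz
      exact zero_ne_one hz
    rw [filter_filter]
    refine Eq.trans (congrArg card ?_) (hfib z z.2 hz0)
    ext y
    simp only [mem_filter, mem_univ, true_and]
    constructor
    · rintro ⟨-, h⟩
      exact congrArg Subtype.val h
    · intro h
      have h3 : (⟨y ^ (q ^ s + 1), hnorm y⟩ : M) = z := Subtype.ext h
      exact ⟨by rw [hform, h3, hz]; ring, h3⟩
  rw [h1, sum_congr rfl h2, sum_const, smul_eq_mul]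
  have h3 : (univ.filter fun z : M => ℓ z = 1).card = q ^ (s - 1) := by
    refine Nat.eq_of_mul_eq_mul_left (by omega : 0 < q) ?_
    rw [hfun, ← pow_succ']
    congr 1; omega
  rw [h3, mul_add, mul_one, ← pow_add]
  congr 2; omega

end FrobeniusForms

/-! ### Vanishing moments and linearized maps -/

section Moments

open Finset

/-- The functions `f : K → K` with `∑ x, f x * x ^ k = 0` for `1 ≤ k < δ`. -/
def momentFree (K : Type*) [Field K] [Fintype K] (δ : ℕ) : Submodule K (K → K) where
  carrier := {f | ∀ k, 1 ≤ k → k < δ → ∑ x, f x * x ^ k = 0}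
  add_mem' := by
    intro f g hf hg k hk1 hk
    simp only [Pi.add_apply, add_mul, sum_add_distrib, hf k hk1 hk, hg k hk1 hk, add_zero]
  zero_mem' := by
    intro k _ _
    simp
  smul_mem' := by
    intro c f hf k hk1 hk
    simp only [Pi.smul_apply, smul_eq_mul, mul_assoc, ← mul_sum, hf k hk1 hk, mul_zero]

variable {K : Type*} [Field K] [Fintype K]

lemma sum_pow_eq_zero {N : ℕ} (hN : ¬ Fintype.card K - 1 ∣ N) : ∑ x : K, x ^ N = 0 := by
  classical
  obtain ⟨α, hα⟩ := IsCyclic.exists_generator (α := Kˣ)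
  have hord : orderOf α = Fintype.card K - 1 := by
    rw [orderOf_eq_card_of_forall_mem_zpowers hα, Nat.card_eq_fintype_card, Fintype.card_units]
  have h1 : (α : K) ^ N ≠ 1 := by
    intro h
    apply hN
    rw [← hord]
    exact orderOf_dvd_of_pow_eq_one (Units.ext (by simpa using h))
  have h2 : (α : K) ^ N * ∑ x : K, x ^ N = ∑ x : K, x ^ N := by
    rw [mul_sum]
    exact Fintype.sum_equiv (Equiv.mulLeft₀ (α : K) α.ne_zero) _ _ fun x => by
      simp [mul_pow]
  have h3 : ((α : K) ^ N - 1) * ∑ x : K, x ^ N = 0 := by rw [sub_mul, h2, one_mul, sub_self]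
  exact (mul_eq_zero.1 h3).resolve_left (sub_ne_zero.2 h1)

lemma pow_mem_momentFree {E t δ : ℕ} (h : E ≡ t [MOD Fintype.card K - 1])
    (ht : t + δ ≤ Fintype.card K - 1) : (fun x : K => x ^ E) ∈ momentFree K δ := by
  intro k hk1 hk
  simp only [← pow_add]
  refine sum_pow_eq_zero fun hdvd => ?_
  have h1 : t + k ≡ 0 [MOD Fintype.card K - 1] :=
    (h.symm.add_right k).trans (Nat.modEq_zero_iff_dvd.2 hdvd)
  have := Nat.le_of_dvd (by omega) (Nat.modEq_zero_iff_dvd.1 h1)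
  omega

lemma const_mem_momentFree {δ : ℕ} (hδ : δ ≤ Fintype.card K - 1) (c : K) :
    (fun _ => c : K → K) ∈ momentFree K δ := by
  have h := (momentFree K δ).smul_mem c
    (pow_mem_momentFree (E := 0) (t := 0) (δ := δ) rfl (by omega))
  convert h using 2
  simp

variable {F : Type*} [Field F] [Fintype F] [Algebra F K]

lemma trace_mul_pow_mem_momentFree {δ E : ℕ} (η : K)
    (h : ∀ l, ∃ t, E * Fintype.card F ^ l ≡ t [MOD Fintype.card K - 1] ∧
      t + δ ≤ Fintype.card K - 1) :
    (fun x => algebraMap F K (Algebra.trace F K (η * x ^ E))) ∈ momentFree K δ := by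
  have h1 : (fun x => algebraMap F K (Algebra.trace F K (η * x ^ E))) =
      ∑ l ∈ range (Module.finrank F K), η ^ Fintype.card F ^ l •
        fun x : K => x ^ (E * Fintype.card F ^ l) := by
    ext x
    rw [FiniteField.algebraMap_trace_eq_sum_pow, Finset.sum_apply]
    simp [mul_pow, pow_mul]
  rw [h1]
  refine Submodule.sum_mem _ fun l _ => Submodule.smul_mem _ _ ?_
  obtain ⟨t, ht, ht'⟩ := h l
  exact pow_mem_momentFree ht ht'

lemma linear_mem_momentFree {δ : ℕ}
    (hδ : Fintype.card F ^ (Module.finrank F K - 1) + δ ≤ Fintype.card K - 1) (ℓ : K →ₗ[F] F) :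
    (fun x => algebraMap F K (ℓ x)) ∈ momentFree K δ := by
  obtain ⟨η, hη⟩ : ∃ η : K, ∀ x, ℓ x = Algebra.trace F K (η * x ^ 1) := by
    refine ⟨((Algebra.traceForm F K).toDual (traceForm_nondegenerate F K)).symm ℓ, fun x => ?_⟩
    have := LinearMap.congr_fun
      (((Algebra.traceForm F K).toDual (traceForm_nondegenerate F K)).apply_symm_apply ℓ) x
    rw [LinearMap.BilinForm.toDual_def, Algebra.traceForm_apply] at this
    rw [pow_one, this]
  simp only [hη]
  refine trace_mul_pow_mem_momentFree η fun l => ?_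
  obtain ⟨b, hb, hb'⟩ := exists_pow_modEq_mul_pow (q := Fintype.card F) (a := 0)
    Fintype.card_pos (Module.finrank_pos (R := F) (M := K)) l
  refine ⟨_, ?_, (add_le_add_left (Nat.pow_le_pow_right Fintype.card_pos
    (show b ≤ Module.finrank F K - 1 by omega)) δ).trans hδ⟩
  rw [Module.card_eq_pow_finrank (K := F) (V := K)]
  simpa using hb'.symm

/-- Monomials `x ^ (q ^ u + q ^ v)` whose exponents are cyclically at distance at least `r`. -/
lemma trace_mul_pow_add_pow_mem_momentFree {δ r u v w : ℕ} (η : K) (hr : 1 ≤ r) (hw : r ≤ w)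
    (hw' : w + r ≤ Module.finrank F K) (huv : v ≡ u + w [MOD Module.finrank F K])
    (hδ : Fintype.card F ^ (Module.finrank F K - 1) +
      Fintype.card F ^ (Module.finrank F K - 1 - r) + δ ≤ Fintype.card K - 1) :
    (fun x => algebraMap F K (Algebra.trace F K
      (η * (x ^ Fintype.card F ^ u * x ^ Fintype.card F ^ v)))) ∈ momentFree K δ := by
  have h1 : ∀ x : K, x ^ Fintype.card F ^ u * x ^ Fintype.card F ^ v =
      x ^ ((Fintype.card F ^ w + Fintype.card F ^ 0) * Fintype.card F ^ u) := by
    intro x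
    rw [pow_pow_eq_of_modEq F huv, ← pow_add, add_mul, ← pow_add, ← pow_add, zero_add]
    congr 1
    rw [add_comm, add_comm w]
  simp only [h1]
  refine trace_mul_pow_mem_momentFree η fun l => ?_
  have hs : IsSpread (Fintype.card F) (Module.finrank F K) r
      (Fintype.card F ^ w + Fintype.card F ^ 0) :=
    ⟨w, 0, by omega, by omega, by omega, rfl⟩
  obtain ⟨t, ht, ht'⟩ := hs.exists_modEq_mul_pow Fintype.card_pos (u + l)
  refine ⟨t, ?_, (add_le_add_left (ht.le Fintype.card_pos) δ).trans hδ⟩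
  rw [Module.card_eq_pow_finrank (K := F) (V := K), mul_assoc, ← pow_add]
  exact ht'.symm

end Moments

section Linearized

open Finset

variable {F : Type*} [Field F] [Fintype F] {K : Type*} [Field K] [Fintype K] [Algebra F K]

/-- The linear map `x ↦ ∑ k, (μ k * x) ^ (q ^ (-k))`, where the inverse of the Frobenius is
written as its `(m - 1)`-st power, `m = [K : F]`. -/
noncomputable def linearizedMap {a : ℕ} (μ : Fin (a + 1) → K) : K →ₗ[F] K :=
  ∑ k : Fin (a + 1), frobPow F K ((Module.finrank F K - 1) * k) ∘ₗ LinearMap.mulLeft F (μ k)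

omit [Fintype K] in
lemma linearizedMap_apply {a : ℕ} (μ : Fin (a + 1) → K) (x : K) :
    linearizedMap (F := F) μ x =
      ∑ k : Fin (a + 1), (μ k * x) ^ Fintype.card F ^ ((Module.finrank F K - 1) * k) := by
  simp [linearizedMap]

lemma sub_one_mul_add_modEq {m k : ℕ} (hm : 1 ≤ m) : (m - 1) * k + k ≡ 0 [MOD m] := by
  obtain ⟨l, rfl⟩ : ∃ l, m = l + 1 := ⟨m - 1, by omega⟩
  rw [Nat.modEq_zero_iff_dvd, Nat.add_sub_cancel]
  exact ⟨k, by ring⟩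

/-- `linearizedMap μ` is the trace adjoint of the linearized polynomial `∑ k, μ k X ^ (q ^ k)`. -/
lemma trace_linearizedMap_mul {a : ℕ} (μ : Fin (a + 1) → K) (x z : K) :
    Algebra.trace F K (linearizedMap (F := F) μ x * z) =
      Algebra.trace F K (x * ∑ k : Fin (a + 1), μ k * z ^ Fintype.card F ^ (k : ℕ)) := by
  rw [linearizedMap_apply, sum_mul, mul_sum, map_sum, map_sum]
  refine sum_congr rfl fun k _ => ?_
  rw [← trace_pow_pow F (x * _) ((Module.finrank F K - 1) * k)]
  congr 1
  have h1 : (z ^ Fintype.card F ^ (k : ℕ)) ^ Fintype.card F ^ ((Module.finrank F K - 1) * k) =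
      z := by
    rw [← pow_mul, ← pow_add, add_comm,
      pow_pow_eq_of_modEq F (sub_one_mul_add_modEq (Module.finrank_pos (R := F) (M := K))),
      pow_zero, pow_one]
  rw [mul_left_comm, ← mul_assoc, mul_pow (μ k * x), h1]

lemma finrank_ker_linearizedMap_le {a : ℕ} {μ : Fin (a + 1) → K} (hμ : μ ≠ 0) :
    Module.finrank F (LinearMap.ker (linearizedMap (F := F) μ)) ≤ a := by
  classical
  set q := Fintype.card F with hq
  have hq1 : 1 < q := Fintype.one_lt_card
  -- the `q ^ a`-th power of the map is a polynomial of degree at most `q ^ a`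
  let P : K[X] := ∑ k : Fin (a + 1), C (μ k ^ q ^ (a - k)) * X ^ q ^ (a - k)
  have hP : ∀ x, P.eval x = linearizedMap (F := F) μ x ^ q ^ a := by
    intro x
    have h1 : linearizedMap (F := F) μ x ^ q ^ a = frobPow F K a (linearizedMap (F := F) μ x) :=
      (frobPow_apply F a _).symm
    rw [h1, linearizedMap_apply, map_sum, eval_finsetSum]
    refine sum_congr rfl fun k _ => ?_
    have h2 : (Module.finrank F K - 1) * k + a ≡ a - k [MOD Module.finrank F K] := by
      have h3 := (sub_one_mul_add_modEq (m := Module.finrank F K) (k := k)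
        Module.finrank_pos).add_right (a - k)
      rwa [zero_add, show (Module.finrank F K - 1) * (k : ℕ) + k + (a - k) =
        (Module.finrank F K - 1) * k + a by have := k.2; omega] at h3
    rw [frobPow_apply, ← pow_mul, ← pow_add, pow_pow_eq_of_modEq F h2, mul_pow]
    simp [hq]
  have hP0 : P ≠ 0 := by
    obtain ⟨k₀, hk₀⟩ := Function.ne_iff.1 hμ
    intro h
    have h1 : P.coeff (q ^ (a - k₀)) = μ k₀ ^ q ^ (a - k₀) := by
      simp only [P, finsetSum_coeff, coeff_C_mul_X_pow]
      rw [sum_eq_single k₀]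
      · simp
      · intro k _ hk
        rw [if_neg]
        intro h2
        have h3 := Nat.pow_right_injective hq1 h2
        exact hk (Fin.ext (by have := k.2; have := k₀.2; omega))
      · simp
    rw [h, coeff_zero] at h1
    exact hk₀ (eq_zero_of_pow_eq_zero h1.symm)
  have hdeg : P.natDegree ≤ q ^ a := by
    refine natDegree_sum_le_of_forall_le _ _ fun k _ => ?_
    exact (natDegree_C_mul_X_pow_le _ _).trans (Nat.pow_le_pow_right hq1.le (by omega))
  have hcard := card_le_degree_of_subset_roots (p := P)
    (Z := univ.filter fun x => x ∈ LinearMap.ker (linearizedMap (F := F) μ)) (by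
      intro x hx
      have hx' : linearizedMap (F := F) μ x = 0 := by
        rw [Finset.mem_val] at hx
        simpa using hx
      rw [mem_roots hP0, IsRoot.def, hP, hx', zero_pow (by positivity)])
  rw [← Fintype.card_subtype] at hcard
  have h1 := card_submodule (LinearMap.ker (linearizedMap (F := F) μ))
  have h2 : q ^ Module.finrank F (LinearMap.ker (linearizedMap (F := F) μ)) ≤ q ^ a := by
    rw [← h1]
    exact hcard.trans hdeg
  exact (Nat.pow_le_pow_iff_right hq1).1 h2

/-- A nonzero linearized polynomial of `q`-degree at most `dim I` vanishing on `ρ I`: its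
`dim I + 1` coefficients are subject to `dim I` linear equations. -/
lemma exists_ne_zero_sum_mul_pow_eq_zero {a : ℕ} (I : Submodule F K)
    (hI : Module.finrank F I = a) (ρ : K →ₗ[F] K) :
    ∃ μ : Fin (a + 1) → K, μ ≠ 0 ∧
      ∀ i ∈ I, ∑ k : Fin (a + 1), μ k * ρ i ^ Fintype.card F ^ (k : ℕ) = 0 := by
  let b := Module.finBasisOfFinrankEq F I hI
  let Ψ : (Fin (a + 1) → K) →ₗ[K] (Fin a → K) :=
    LinearMap.pi fun t => ∑ k : Fin (a + 1),
      (LinearMap.proj k).smulRight (ρ (b t) ^ Fintype.card F ^ (k : ℕ))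
  have hker : LinearMap.ker Ψ ≠ ⊥ := LinearMap.ker_ne_bot_of_finrank_lt (by simp)
  obtain ⟨μ, hμ, hμ0⟩ := (Submodule.ne_bot_iff _).1 hker
  refine ⟨μ, hμ0, fun i hi => ?_⟩
  let T : K →ₗ[F] K := ∑ k : Fin (a + 1), LinearMap.mulLeft F (μ k) ∘ₗ frobPow F K k ∘ₗ ρ
  have hT : ∀ x, T x = ∑ k : Fin (a + 1), μ k * ρ x ^ Fintype.card F ^ (k : ℕ) := by
    intro x; simp [T]
  have hTI : T ∘ₗ I.subtype = 0 := by
    refine b.ext fun t => ?_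
    have := congrFun (LinearMap.mem_ker.1 hμ) t
    simpa [Ψ, hT] using this
  rw [← hT]
  exact LinearMap.congr_fun hTI ⟨i, hi⟩

omit [Fintype F] in
open Classical in
lemma card_filter_comp {V W : Type*} [AddCommGroup V] [AddCommGroup W] [Module F V] [Module F W]
    [Fintype V] [Fintype W] (T : V →ₗ[F] W) (p : W → Prop) :
    (univ.filter fun x => p (T x)).card =
      Fintype.card (LinearMap.ker T) * (univ.filter fun y => y ∈ LinearMap.range T ∧ p y).card := by
  have h1 := card_eq_sum_card_fiberwise (f := T) (s := univ.filter fun x => p (T x))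
    (t := univ.filter fun y => y ∈ LinearMap.range T ∧ p y) (by
      intro x hx
      simp only [coe_filter, mem_univ, true_and, Set.mem_ofPred_eq] at hx ⊢
      exact ⟨⟨x, rfl⟩, hx⟩)
  rw [h1, mul_comm, ← smul_eq_mul, ← sum_const]
  refine sum_congr rfl fun y hy => ?_
  simp only [mem_filter, mem_univ, true_and] at hy
  obtain ⟨⟨x₀, rfl⟩, hp⟩ := hy
  rw [Fintype.card_subtype]
  refine card_bij (fun x _ => x - x₀) ?_ ?_ ?_
  · intro x hx
    simp only [mem_filter, mem_univ, true_and] at hx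
    simp [hx.2]
  · intro x _ x' _ h
    exact sub_left_injective h
  · intro z hz
    simp only [mem_filter, mem_univ, true_and, LinearMap.mem_ker] at hz
    exact ⟨z + x₀, by simp [hz, hp], by simp⟩

end Linearized

/-! ### Quadratic functions with many zeros -/

section QuadraticFunction

open Finset

variable {F : Type*} [Field F] [Fintype F] {K : Type*} [Field K] [Fintype K] [Algebra F K]

open Classical in
/-- For `d = ⌊m / 2⌋`, a form `Tr (γ x y ^ (q ^ d))` and a totally singular subspace `I` of
dimension `a` such that a quadratic function `Q + L + c` has many zeros on the orthogonal space
of `I`. -/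
lemma exists_frobForm_singular {m a : ℕ} (hm : Module.finrank F K = m) (ha : a + 1 ≤ m / 2) :
    ∃ (γ : K) (I : Submodule F K) (L : K →ₗ[F] F) (c : F), Module.finrank F I = a ∧
      Module.finrank F (polarPerp (frobForm (F := F) γ (m / 2)) I) = m - a ∧
      (univ.filter fun y => y ∈ polarPerp (frobForm (F := F) γ (m / 2)) I ∧
        frobForm (F := F) γ (m / 2) y y + L y + c = 0).card =
        Fintype.card F ^ (m - a - 1) + Fintype.card F ^ ((m - 1) / 2) := by
  obtain ⟨s, hs | hs⟩ := Nat.even_or_odd' m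
  · rw [show m / 2 = s by omega] at ha ⊢
    obtain ⟨γ, hγ⟩ := exists_add_pow_eq_one (F := F) (K := K) (s := s) (by omega) (by omega)
    obtain ⟨I, hI, -, hperp, hcard⟩ := exists_singular_card_zeros_of_even (a := a) (s := s)
      (β := frobForm (F := F) γ s) (by omega) ha
      (fun x _ h => frobForm_nondegenerate_of_even (by omega) hγ x h)
      (card_frobForm_eq_one (by omega) (by omega) hγ)
    refine ⟨γ, I, 0, -1, hI, by omega, ?_⟩
    simp only [LinearMap.zero_apply, add_zero]
    rw [hcard, hs, show (2 * s - 1) / 2 = s - 1 by omega]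
  · rw [show m / 2 = s by omega] at ha ⊢
    obtain ⟨I, L, hI, -, hperp, hcard⟩ := exists_singular_card_zeros_of_odd (a := a) (n := s)
      (β := frobForm (F := F) (1 : K) s) (by omega) (by omega)
      (fun x hx h => frobForm_one_nondegenerate_of_odd (by omega) x hx h)
    refine ⟨1, I, L, 0, hI, by omega, ?_⟩
    simp only [add_zero]
    rw [hcard, hs, show (2 * s + 1 - 1) / 2 = s by omega,
      show 2 * s + 1 - a - 1 = 2 * s - a by omega]

/-- Substituting the linearized map changes the cyclic distance `⌊m / 2⌋` of the exponents of the
form by at most `a`. -/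
lemma frobForm_linearizedMap_mem_momentFree {m a δ : ℕ} (hm : Module.finrank F K = m)
    (ha : a + 1 ≤ m / 2)
    (hδ : δ + (Fintype.card F ^ (m - 1) + Fintype.card F ^ ((m - 1) / 2 + a)) =
      Fintype.card F ^ m - 1) (γ : K) (μ : Fin (a + 1) → K) :
    (fun x => algebraMap F K (frobForm (F := F) γ (m / 2) (linearizedMap (F := F) μ x)
      (linearizedMap (F := F) μ x))) ∈ momentFree K δ := by
  let u : Fin (a + 1) → ℕ := fun k => (m - 1) * k
  have h1 : (fun x => algebraMap F K (frobForm (F := F) γ (m / 2) (linearizedMap (F := F) μ x)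
      (linearizedMap (F := F) μ x))) = ∑ k, ∑ k', fun x => algebraMap F K (Algebra.trace F K
        ((γ * μ k ^ Fintype.card F ^ u k * μ k' ^ Fintype.card F ^ (u k' + m / 2)) *
          (x ^ Fintype.card F ^ u k * x ^ Fintype.card F ^ (u k' + m / 2)))) := by
    ext x
    simp only [Finset.sum_apply]
    rw [linearizedMap_apply, LinearMap.map_sum₂, map_sum]
    refine sum_congr rfl fun k _ => ?_
    rw [map_sum, map_sum]
    refine sum_congr rfl fun k' _ => ?_
    rw [frobForm_apply, ← pow_mul, ← pow_add, hm, mul_pow, mul_pow]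
    congr 2
    simp only [u]
    ring
  rw [h1]
  refine Submodule.sum_mem _ fun k _ => Submodule.sum_mem _ fun k' _ => ?_
  have hk := k.2
  have hk' := k'.2
  -- modulo `m` the exponents of `q` are `-k` and `⌊m / 2⌋ - k'`
  refine trace_mul_pow_add_pow_mem_momentFree (r := m / 2 - a) (w := m / 2 + k - k') _ (by omega)
    (by omega) (by omega) ?_ ?_
  · rw [hm]
    apply Nat.ModEq.add_right_cancel' (k' : ℕ)
    have e1 : u k' + m / 2 + k' ≡ 0 + m / 2 [MOD m] := by
      rw [add_right_comm]
      exact (sub_one_mul_add_modEq (by omega)).add_right _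
    have e2 : u k + (m / 2 + k - k') + k' ≡ 0 + m / 2 [MOD m] := by
      rw [show u k + (m / 2 + k - k') + k' = u k + k + m / 2 by omega]
      exact (sub_one_mul_add_modEq (by omega)).add_right _
    exact e1.trans e2.symm
  · rw [hm, Module.card_eq_pow_finrank (K := F) (V := K), hm,
      show m - 1 - (m / 2 - a) = (m - 1) / 2 + a by omega]
    omega

open Classical in
/-- A quadratic function whose exponents avoid the moments below `δ` and whose number of zeros is
as large as the BCH bound permits: compose a quadratic function in the orthogonal space of a
totally singular subspace `I` with a linearized map onto that space. -/
theorem exists_function_of_lt_half {m a δ : ℕ} (hm : Module.finrank F K = m)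
    (ha : a + 1 ≤ m / 2)
    (hδ : δ + (Fintype.card F ^ (m - 1) + Fintype.card F ^ ((m - 1) / 2 + a)) =
      Fintype.card F ^ m - 1) (hδ1 : 1 ≤ δ) :
    ∃ f : K → F, f 0 ≠ 0 ∧ (univ.filter fun x => f x = 0).card =
        Fintype.card F ^ (m - 1) + Fintype.card F ^ ((m - 1) / 2 + a) ∧
      (fun x => algebraMap F K (f x)) ∈ momentFree K δ := by
  set q := Fintype.card F with hq
  obtain ⟨γ, I, L, c, hI, hperp, hcard⟩ := exists_frobForm_singular (F := F) hm ha
  set β := frobForm (F := F) γ (m / 2) with hβ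
  obtain ⟨μ, hμ0, hμ⟩ := exists_ne_zero_sum_mul_pow_eq_zero I hI (frobAdj (F := F) γ (m / 2))
  set A := linearizedMap (F := F) μ with hA
  have hker : Module.finrank F (LinearMap.ker A) ≤ a := finrank_ker_linearizedMap_le (F := F) hμ0
  have hrank := LinearMap.finrank_range_add_finrank_ker A
  have hle : LinearMap.range A ≤ polarPerp β I := by
    rintro _ ⟨x, rfl⟩
    rw [mem_polarPerp]
    intro i hi
    rw [frobForm_polar (by omega), trace_linearizedMap_mul, hμ i hi, mul_zero, map_zero]
  have hrange : LinearMap.range A = polarPerp β I :=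
    Submodule.eq_of_le_of_finrank_le hle (by omega)
  rw [hrange] at hrank
  have hkera : Module.finrank F (LinearMap.ker A) = a := by omega
  let g : K → F := fun y => β y y + L y + c
  have hzeros : (univ.filter fun x => g (A x) = 0).card = q ^ (m - 1) + q ^ ((m - 1) / 2 + a) := by
    rw [card_filter_comp A (fun y => g y = 0), hrange, hcard, card_submodule, hkera, mul_add,
      ← pow_add, ← pow_add, show a + (m - a - 1) = m - 1 by omega, add_comm a]
  have hK : Fintype.card K = q ^ m := by rw [Module.card_eq_pow_finrank (K := F), hm]
  -- translating the argument makes the value at `0` nonzero and keeps the quadratic part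
  obtain ⟨x₀, hx₀⟩ : ∃ x₀, g (A x₀) ≠ 0 := by
    by_contra! h
    rw [filter_true_of_mem fun x _ => h x, card_univ, hK] at hzeros
    omega
  refine ⟨fun x => g (A (x + x₀)), by simpa using hx₀, ?_, ?_⟩
  · rw [← hzeros]
    refine card_bij (fun x _ => x + x₀) ?_ (fun x _ y _ h => add_left_injective _ h) ?_
    · intro x hx
      simpa using hx
    · intro y hy
      exact ⟨y - x₀, by simpa using hy, by simp⟩
  · let ℓ : K →ₗ[F] F := β.flip (A x₀) ∘ₗ A + β (A x₀) ∘ₗ A + L ∘ₗ A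
    have h1 : (fun x => algebraMap F K (g (A (x + x₀)))) =
        (fun x => algebraMap F K (β (A x) (A x))) + (fun x => algebraMap F K (ℓ x)) +
          fun _ => algebraMap F K (g (A x₀)) := by
      have h2 : ∀ y y₀, g (y + y₀) = β y y + (β y y₀ + β y₀ y + L y) + g y₀ := by
        intro y y₀
        simp only [g, map_add, LinearMap.add_apply]
        ring
      ext x
      rw [Pi.add_apply, Pi.add_apply, map_add A, h2, map_add, map_add]
      rfl
    rw [h1]
    have hn : Fintype.card K - 1 = q ^ m - 1 := by rw [hK]
    refine Submodule.add_mem _ (Submodule.add_mem _ ?_ ?_) ?_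
    · exact frobForm_linearizedMap_mem_momentFree hm ha hδ γ μ
    · exact linear_mem_momentFree (by rw [hn, hm, ← hq]; omega) ℓ
    · exact const_mem_momentFree (by rw [hn]; omega) _

open Classical in
/-- For a quadratic extension, a product of two parallel affine functions has `2 * q` zeros. -/
theorem exists_function_of_finrank_eq_two {δ : ℕ} (hm : Module.finrank F K = 2)
    (hδ : δ + (Fintype.card F + Fintype.card F) = Fintype.card F ^ 2 - 1) (hδ1 : 1 ≤ δ) :
    ∃ f : K → F, f 0 ≠ 0 ∧ (univ.filter fun x => f x = 0).card =
        Fintype.card F + Fintype.card F ∧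
      (fun x => algebraMap F K (f x)) ∈ momentFree K δ := by
  set q := Fintype.card F with hq
  have hq1 : 1 < q := Fintype.one_lt_card
  -- for `q = 2` the hypothesis on `δ` would read `δ + 4 = 3`
  have hq2 : q ≠ 2 := by
    intro h
    rw [h] at hδ
    omega
  obtain ⟨u, hu0, hu1⟩ : ∃ u : F, u ≠ 0 ∧ u ≠ 1 := by
    by_contra! h
    have : (univ : Finset F) ⊆ {0, 1} := fun u _ => by
      by_cases h0 : u = 0
      · simp [h0]
      · simp [h u h0]
    have := card_le_card this
    rw [card_univ, card_pair zero_ne_one] at this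
    omega
  have hK : Fintype.card K = q ^ 2 := by rw [Module.card_eq_pow_finrank (K := F), hm]
  have hn : Fintype.card K - 1 = q ^ 2 - 1 := by rw [hK]
  let T : K →ₗ[F] F := Algebra.trace F K
  have hT : T ≠ 0 := Algebra.trace_ne_zero F K
  have hfib : ∀ d, (univ.filter fun x => T x = d).card = q := by
    intro d
    have h := card_functional_fiber T hT d
    rw [hK, pow_two] at h
    exact Nat.eq_of_mul_eq_mul_left (by omega) h
  refine ⟨fun x => (T x - 1) * (T x - u), ?_, ?_, ?_⟩
  · simp [hu0]
  · have h1 : (univ.filter fun x => (T x - 1) * (T x - u) = 0) =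
        (univ.filter fun x => T x = 1) ∪ univ.filter fun x => T x = u := by
      ext x
      simp [sub_eq_zero]
    rw [h1, card_union_of_disjoint, hfib, hfib]
    rw [disjoint_filter]
    intro x _ h h'
    exact hu1 (h'.symm.trans h)
  · have h1 : (fun x => algebraMap F K ((T x - 1) * (T x - u))) =
        (∑ l ∈ range 2, ∑ l' ∈ range 2, fun x : K => x ^ (q ^ l + q ^ l')) +
          (fun x => algebraMap F K ((-(1 + u) • T) x)) + fun _ => algebraMap F K u := by
      ext x
      have h2 : algebraMap F K (T x) = ∑ l ∈ range 2, x ^ q ^ l := by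
        have := FiniteField.algebraMap_trace_eq_sum_pow F K x
        rwa [hm, Nat.card_eq_fintype_card] at this
      have h3 : (T x - 1) * (T x - u) = T x * T x + (-(1 + u) • T) x + u := by
        rw [LinearMap.smul_apply, smul_eq_mul]; ring
      simp only [Pi.add_apply, Finset.sum_apply]
      rw [h3, map_add, map_add, map_mul, h2, sum_mul_sum]
      simp only [pow_add]
    rw [h1]
    refine Submodule.add_mem _ (Submodule.add_mem _ ?_ ?_) ?_
    · refine Submodule.sum_mem _ fun l hl => Submodule.sum_mem _ fun l' hl' => ?_
      refine pow_mem_momentFree (t := q ^ l + q ^ l') rfl ?_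
      rw [mem_range] at hl hl'
      have h2 : ∀ j < 2, q ^ j ≤ q := fun j hj =>
        (Nat.pow_le_pow_right hq1.le (show j ≤ 1 by omega)).trans (pow_one q).le
      have := h2 l hl
      have := h2 l' hl'
      omega
    · exact linear_mem_momentFree (by rw [hn, hm, ← hq, show 2 - 1 = 1 from rfl, pow_one]; omega) _
    · exact const_mem_momentFree (by omega) _

end QuadraticFunction

/-! ### Codewords of weight equal to the designed distance -/

section Codeword

variable {F : Type*} [Field F] {K : Type*} [Field K] [Fintype K] [Algebra F K]

open Finset in
lemma sum_primitiveRoot_pow_add {M : Type*} [AddCommMonoid M] {α : K} {n : ℕ}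
    (hα : IsPrimitiveRoot α n) (hn : n + 1 = Fintype.card K) (h : K → M) :
    ∑ j : Fin n, h (α ^ (j : ℕ)) + h 0 = ∑ x, h x := by
  classical
  have hn0 : n ≠ 0 := fun h0 => by
    have := Fintype.one_lt_card (α := K)
    omega
  have hinj : Function.Injective fun j : Fin n => α ^ (j : ℕ) :=
    fun i j hij => Fin.ext (hα.pow_inj i.2 j.2 hij)
  have himg : univ.image (fun j : Fin n => α ^ (j : ℕ)) = univ.erase 0 := by
    refine eq_of_subset_of_card_le ?_ ?_
    · intro x hx
      obtain ⟨j, -, rfl⟩ := mem_image.1 hx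
      exact mem_erase.2 ⟨pow_ne_zero _ (hα.ne_zero hn0), mem_univ _⟩
    · rw [card_erase_of_mem (mem_univ _), card_image_of_injective _ hinj, card_univ, card_univ,
        Fintype.card_fin]
      omega
  rw [← sum_erase_add univ h (mem_univ 0), ← himg, sum_image fun i _ j _ hij => hinj hij]

lemma evaluation_mem_bchCode {α : K} {n δ : ℕ} (hα : IsPrimitiveRoot α n)
    (hn : n + 1 = Fintype.card K) {f : K → F}
    (hf : (fun x => algebraMap F K (f x)) ∈ momentFree K δ) :
    (fun j : Fin n => f (α ^ (j : ℕ))) ∈ bchCode F α n δ 1 := by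
  rw [mem_bchCode_iff hα.pow_eq_one]
  intro k hk1 hk
  have h1 := sum_primitiveRoot_pow_add hα hn fun x => algebraMap F K (f x) * x ^ k
  rw [hf k hk1 hk, zero_pow (by omega), mul_zero, add_zero] at h1
  exact h1

omit [Algebra F K] in
open Classical in
lemma hammingNorm_evaluation_add {α : K} {n : ℕ} (hα : IsPrimitiveRoot α n)
    (hn : n + 1 = Fintype.card K) {f : K → F} (hf : f 0 ≠ 0) :
    hammingNorm (fun j : Fin n => f (α ^ (j : ℕ))) +
      (Finset.univ.filter fun x => f x = 0).card = n := by
  have h1 := sum_primitiveRoot_pow_add hα hn fun x => if f x ≠ 0 then 1 else 0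
  rw [if_pos hf, ← Finset.card_filter, ← Finset.card_filter] at h1
  have h2 := Finset.card_filter_add_card_filter_not (s := Finset.univ) (fun x => f x = 0)
  rw [Finset.card_univ, ← hn] at h2
  simp only [hammingNorm, ne_eq] at h1 ⊢
  omega

end Codeword

theorem theorem11 {F : Type*} [Field F] [Fintype F] {K : Type*} [Field K] [Algebra F K]
    (q m : ℕ) (hq : Fintype.card F = q) (hm : Module.finrank F K = m)
    (α : Kˣ) (hα : ∀ x : Kˣ, x ∈ Subgroup.zpowers α)
    (hqm : ¬ (q = 2 ∧ m = 2))
    (i : ℕ) (hi : 3 ≤ i)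
    (him : (i : ℤ) ≤ m - (⌊((m : ℚ) - 1) / 2⌋ + ⌊((m : ℚ) - 3) / 3⌋)) :
    ∃ δ k : ℕ,
      IsNthLargest (cosetLeaders q (q ^ m - 1) m) i δ ∧
      (δ : ℤ) = ((q : ℤ) - 1) * q ^ (m - 1) - 1 - q ^ ((m - 1) / 2 + i - 2) ∧
      (k : ℚ) = (if Even m then ((i : ℚ) - 1 / 2) * m + 1 else (i : ℚ) * m + 1) ∧
      HasParameters (bchCode F (α : K) (q ^ m - 1) δ 1) k δ := by
  classical
  have hfl1 : ⌊((m : ℚ) - 1) / 2⌋ = ((m : ℤ) - 1) / 2 := by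
    have := Rat.floor_intCast_div_natCast ((m : ℤ) - 1) 2
    push_cast at this
    exact this
  have hfl2 : ⌊((m : ℚ) - 3) / 3⌋ = ((m : ℤ) - 3) / 3 := by
    have := Rat.floor_intCast_div_natCast ((m : ℤ) - 3) 3
    push_cast at this
    exact this
  rw [hfl1, hfl2] at him
  subst hq
  set q := Fintype.card F with hq
  have hq2 : 2 ≤ q := Fintype.one_lt_card
  obtain ⟨e, he⟩ : ∃ e, (m - 1) / 2 + i - 2 = e := ⟨_, rfl⟩
  rw [he]
  have hm2 : 2 ≤ m := by omega
  have hem : e < m := by omega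
  have hme : m < 3 * (m - e) := by omega
  have hfin : FiniteDimensional F K := FiniteDimensional.of_finrank_pos (by omega)
  have : Finite K := Module.finite_of_finite F
  have := Fintype.ofFinite K
  have hK : Fintype.card K = q ^ m := by rw [Module.card_eq_pow_finrank (K := F), hm]
  have hpow : q ^ m = q ^ (m - 1) * q := by rw [← pow_succ]; congr 1; omega
  have hN : q ^ (m - 1) + q ^ e + 2 ≤ q ^ m := by
    rcases hm2.eq_or_lt with rfl | hm3
    · obtain rfl : e = 1 := by omega
      have hq3 : 3 ≤ q := by omega
      norm_num
      nlinarith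
    · have h1 : q ^ e ≤ q ^ (m - 2) := Nat.pow_le_pow_right (by omega) (by omega)
      have h2 : q ^ (m - 1) = q ^ (m - 2) * q := by rw [← pow_succ]; congr 1; omega
      have h3 : q ^ 1 ≤ q ^ (m - 2) := Nat.pow_le_pow_right (by omega) (by omega)
      rw [pow_one] at h3
      have h4 : q ^ (m - 1) * 2 ≤ q ^ (m - 1) * q := Nat.mul_le_mul_left _ hq2
      have h5 : q ^ (m - 2) * 2 ≤ q ^ (m - 2) * q := Nat.mul_le_mul_left _ hq2
      omega
  obtain ⟨δ, hδ⟩ : ∃ δ, δ + (q ^ (m - 1) + q ^ e) = q ^ m - 1 :=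
    ⟨q ^ m - 1 - (q ^ (m - 1) + q ^ e), by omega⟩
  have hδ1 : 1 ≤ δ := by omega
  have hprim : IsPrimitiveRoot (α : K) (q ^ m - 1) := by
    rw [← hK, ← Fintype.card_units, ← Nat.card_eq_fintype_card,
      ← orderOf_eq_card_of_forall_mem_zpowers hα, ← orderOf_units]
    exact IsPrimitiveRoot.orderOf _
  have hnK : q ^ m - 1 + 1 = Fintype.card K := by omega
  have hnF : ((q ^ m - 1 : ℕ) : F) ≠ 0 := by
    rw [Nat.cast_sub (by omega), Nat.cast_pow, hq, FiniteField.cast_card_eq_zero,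
      zero_pow (by omega)]
    simp
  obtain ⟨f, hf0, hfz, hf⟩ : ∃ f : K → F, f 0 ≠ 0 ∧
      (Finset.univ.filter fun x => f x = 0).card = q ^ (m - 1) + q ^ e ∧
      (fun x => algebraMap F K (f x)) ∈ momentFree K δ := by
    rcases hm2.eq_or_lt with rfl | hm3
    · obtain rfl : e = 1 := by omega
      simp only [Nat.add_one_sub_one, pow_one] at hδ ⊢
      exact exists_function_of_finrank_eq_two hm hδ hδ1
    · obtain ⟨a, rfl⟩ : ∃ a, e = (m - 1) / 2 + a := ⟨i - 2, by omega⟩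
      exact exists_function_of_lt_half hm (by omega) hδ hδ1
  refine ⟨δ, Module.finrank F (bchCode F (α : K) (q ^ m - 1) δ 1), ?_, ?_, ?_, rfl, ?_⟩
  · have := isNthLargest_cosetLeaders hq2 hem hme (by omega) hδ
    rwa [show e - (m - 1) / 2 + 2 = i by omega] at this
  · have h1 : ((δ + (q ^ (m - 1) + q ^ e) + 1 : ℕ) : ℤ) = ((q ^ (m - 1) * q : ℕ) : ℤ) := by
      rw [hδ, ← hpow]; congr 1; omega
    push_cast at h1
    linarith
  · rw [finrank_bchCode hprim hnF]
    have h := card_not_conjugate (m := m) (r := m - 1 - e) hq2 (by omega) (by omega)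
      (by rw [show m - 1 - (m - 1 - e) = e by omega]; exact hδ) hδ1
    obtain ⟨s, hs | hs⟩ := Nat.even_or_odd' m
    · rw [if_pos ⟨s, by omega⟩]
      rw [show m + 1 - 2 * (m - 1 - e) = 2 * i - 3 by omega] at h
      have h' := congrArg (Nat.cast : ℕ → ℚ) h
      push_cast [Nat.cast_sub (show 3 ≤ 2 * i by omega)] at h'
      linear_combination h' / 2
    · rw [if_neg (Nat.not_even_iff_odd.2 ⟨s, hs⟩)]
      rw [show m + 1 - 2 * (m - 1 - e) = 2 * i - 2 by omega] at h
      have h' := congrArg (Nat.cast : ℕ → ℚ) h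
      push_cast [Nat.cast_sub (show 2 ≤ 2 * i by omega)] at h'
      linear_combination h' / 2
  · have hn1 : 1 ≤ q ^ m - 1 := by omega
    constructor
    · have hw := hammingNorm_evaluation_add hprim hnK hf0
      refine ⟨_, evaluation_mem_bchCode hprim hnK hf, 0, Submodule.zero_mem _, ?_, ?_⟩
      · rw [← hammingNorm_pos_iff]
        omega
      · rw [hammingDist_zero_right]
        omega
    · rintro _ ⟨x, hx, y, hy, hxy, rfl⟩
      rw [hammingDist_eq_hammingNorm]
      exact le_hammingNorm_of_mem_bchCode hprim hn1
        (Submodule.add_mem _ (Submodule.neg_mem _ hx) hy) (by rwa [Ne, neg_add_eq_zero])
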